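/- For integers $d\ge 0$ and $k_1,\dots,k_d\ge 1$ with $k_d\ge 2$ (if $d\ge1$), let $$\zeta(k_1,\dots,k_d)=\sum_{0<m_1<\cdots<m_d}\frac{1}{m_1^{k_1}\cdots m_d^{k_d}}$$ be the multiple zeta value of weight $k_1+\cdots+k_d$ and depth $d$, where the multiple zeta value of depth $0$ is $1$. **Theorem (parity result for multiple zeta values).** Let $d\ge 1$ and let $k_1,\dots,k_d$ be positive integers with $k_d\ge2$ such that the weight and the depth have opposite parity, that is, $k_1+\cdots+k_d\not\equiv d\pmod 2$. Then $\zeta(k_1,\dots,k_d)$ is a $\mathbb{Q}[\pi^2]$-linear combination of multiple zeta values of depth at most $d-1$; that is, it lies in the $\mathbb{Q}[\pi^2]$-submodule of $\mathbb{R}$ generated by the multiple zeta values of depth at most $d-1$. -/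

import Mathlib

namespace MZV

/-- An index `(k_1, …, k_d)` of depth `d` is admissible if all its entries are positive and its
last entry is at least `2`. The empty index (`d = 0`) is admissible. -/
def Admissible {d : ℕ} (k : Fin d → ℕ) : Prop :=
  (∀ i, 1 ≤ k i) ∧ ∀ i : Fin d, (i : ℕ) + 1 = d → 2 ≤ k i

/-- The tuples of integers `0 < m_1 < ⋯ < m_d`. -/
abbrev Tuples (d : ℕ) : Type := {m : Fin d → ℕ // (∀ i, 0 < m i) ∧ StrictMono m}

/-- The summand `1 / (m_1 ^ k_1 ⋯ m_d ^ k_d)`. -/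
noncomputable def term {d : ℕ} (k : Fin d → ℕ) (m : Tuples d) : ℝ :=
  1 / ∏ i, (m.1 i : ℝ) ^ k i

/-- The multiple zeta value
`ζ(k_1, …, k_d) = ∑_{0 < m_1 < ⋯ < m_d} 1 / (m_1 ^ k_1 ⋯ m_d ^ k_d)`;
the series converges for admissible indices (`summable_term`). -/
noncomputable def zeta {d : ℕ} (k : Fin d → ℕ) : ℝ := ∑' m : Tuples d, term k m

/-- The set of all multiple zeta values of depth at most `n`, over all weights. It contains the
value `1` of depth `0`. -/
def valuesOfDepthLE (n : ℕ) : Set ℝ :=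
  {x | ∃ (e : ℕ) (l : Fin e → ℕ), e ≤ n ∧ Admissible l ∧ x = zeta l}

/-- The subring `ℚ[π²]` of `ℝ`. -/
noncomputable def ratPiSq : Subalgebra ℚ ℝ := Algebra.adjoin ℚ {Real.pi ^ 2}

theorem zeta_empty (k : Fin 0 → ℕ) : zeta k = 1 := by
  have : Unique (Tuples 0) :=
    { default := ⟨Fin.elim0, fun i => i.elim0, fun i => i.elim0⟩
      uniq := fun a => Subtype.ext (Subsingleton.elim _ _) }
  rw [zeta, tsum_eq_single default (fun b hb => absurd (Unique.eq_default b) hb)]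
  simp [term]

theorem summable_prod_pi (d : ℕ) (f : ℕ → ℝ) (h0 : ∀ n, 0 ≤ f n) (hf : Summable f) :
    Summable (fun m : Fin d → ℕ => ∏ i, f (m i)) := by
  induction d with
  | zero => exact Summable.of_finite
  | succ n ih =>
    have h := hf.mul_of_nonneg ih h0 (fun m => Finset.prod_nonneg fun i _ => h0 _)
    rw [← (Fin.consEquiv (fun _ : Fin (n + 1) => ℕ)).summable_iff]
    refine h.congr fun x => ?_
    simp [Fin.consEquiv, Fin.prod_univ_succ]

theorem summable_term {d : ℕ} (k : Fin d → ℕ) (hk : Admissible k) : Summable (term k) := by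
  rcases Nat.eq_zero_or_pos d with rfl | hd
  · exact Summable.of_finite
  obtain ⟨n, rfl⟩ : ∃ n, d = n + 1 := ⟨d - 1, by omega⟩
  set s : ℝ := 1 / (n + 1) with hs
  have hspos : 0 < s := by positivity
  have hf : Summable (fun a : ℕ => 1 / (a : ℝ) ^ (1 + s)) :=
    Real.summable_one_div_nat_rpow.2 (by linarith)
  have hp := (summable_prod_pi (n + 1) _ (fun a => by positivity) hf).comp_injective
    (Subtype.val_injective : Function.Injective (fun m : Tuples (n + 1) => m.1))
  refine Summable.of_nonneg_of_le (fun m => ?_) (fun m => ?_) hp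
  · unfold term; positivity
  · obtain ⟨m, hm, hmono⟩ := m
    have hm1 : ∀ i, (1 : ℝ) ≤ m i := fun i => by exact_mod_cast hm i
    have hm0 : ∀ i, (0 : ℝ) < m i := fun i => by exact_mod_cast hm i
    simp only [term, Function.comp, one_div, Finset.prod_inv_distrib]
    refine inv_anti₀ (Finset.prod_pos fun i _ => Real.rpow_pos_of_pos (hm0 i) _) ?_
    have hlast : ∏ i, (m i : ℝ) ^ s ≤ m (Fin.last n) := by
      calc ∏ i, (m i : ℝ) ^ s ≤ ∏ _i : Fin (n + 1), (m (Fin.last n) : ℝ) ^ s := by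
            refine Finset.prod_le_prod (fun i _ => by positivity) fun i _ => ?_
            refine Real.rpow_le_rpow (hm0 i).le ?_ hspos.le
            exact_mod_cast hmono.monotone (Fin.le_last i)
        _ = m (Fin.last n) := by
            rw [Finset.prod_const, Finset.card_univ, Fintype.card_fin, ← Real.rpow_natCast,
              ← Real.rpow_mul (hm0 _).le, hs]
            push_cast
            rw [one_div_mul_cancel (by positivity), Real.rpow_one]
    calc ∏ i, (m i : ℝ) ^ (1 + s) = (∏ i, (m i : ℝ)) * ∏ i, (m i : ℝ) ^ s := by
          rw [← Finset.prod_mul_distrib]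
          exact Finset.prod_congr rfl fun i _ => by rw [Real.rpow_add (hm0 i), Real.rpow_one]
      _ ≤ (∏ i, (m i : ℝ)) * m (Fin.last n) :=
          mul_le_mul_of_nonneg_left hlast (Finset.prod_nonneg fun i _ => (hm0 i).le)
      _ ≤ ∏ i, (m i : ℝ) ^ k i := by
          rw [Fin.prod_univ_castSucc, Fin.prod_univ_castSucc, mul_assoc]
          refine mul_le_mul ?_ ?_ (by positivity) (by positivity)
          · exact Finset.prod_le_prod (fun i _ => (hm0 _).le) fun i _ =>
              le_self_pow₀ (hm1 _) (by have := hk.1 i.castSucc; omega)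
          · rw [← pow_two]
            exact pow_le_pow_right₀ (hm1 _) (hk.2 (Fin.last n) (by simp))

end MZV

/-!
Let `F(x)` be the sum of `∏ (x + n i) ^ (-k i)` over `-N < n 1 < ⋯ < n d < N`. The residues of the
rational function `F(x) / x` add up to zero. The one at `0` is the sum of `∏ n i ^ (-k i)` over
nonzero `n i` (the bilateral sum) plus terms in which one summation variable has been removed; the
other residues only consist of such terms. So the bilateral sum is a combination of sums, over
`0 < |n| < N`, of `n ^ (-s)` times products of two truncated sums of total depth `d - 1`.
For `s ≥ 2` the dependence of the products on `n` is negligible, and the sum of `n ^ (-s)` over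
`n ≠ 0` tends to `0` or to a rational multiple of `π ^ s` with `s` even. For `s = 1` the
products add up to something negligible, because the residues of `F` itself add up to zero.

Splitting at `0` turns the bilateral sums into the product, with respect to deconcatenation of
words, of the sums over positive and over negative `n i`. The inverse of the latter factor is given
by truncated star sums with the sign `(-1) ^ (depth + weight)`. Hence, if depth and weight have
opposite parity, the truncated sum plus its star version is a combination of products with a
bilateral factor, and these have depth at most `d - 1`; so is the difference of the two sums.

Truncated sums of divergent words also occur. All truncated sums are polynomials in the harmonic
numbers up to errors `O(N ^ (-1/2) (log N) ^ p)`, and the theorem compares the constant terms.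
-/

namespace MZV

open Finset (Ico Ioo range)
open Finset.HasAntidiagonal (antidiagonal)
open Filter Topology
open Polynomial (aeval)

section Chain

variable {α R : Type*}

/-- The sum of `∏ f (n i) (k i)` over integers `a < n 1 < ⋯ < n d < b`. The word lists the letters
in the order `k d, …, k 1`: its head belongs to the largest summation variable, so that the
condition `2 ≤ k d` concerns the head. -/
noncomputable def chain [CommSemiring R] (f : ℤ → α → R) : List α → ℤ → ℤ → R
  | [], _, _ => 1
  | k :: w, a, b => ∑ m ∈ Ioo a b, f m k * chain f w a m

/-- The convolution of two functions on words, with respect to deconcatenation. -/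
def conv [Semiring R] (A B : List α → R) (w : List α) : R :=
  ∑ i ∈ range (w.length + 1), A (w.take i) * B (w.drop i)

/-- The unit of the convolution product. -/
def convOne [Semiring R] : List α → R
  | [] => 1
  | _ :: _ => 0

/-- The functional `k :: u ↦ g k * B u` on words, which is the convolution of `B` with the
functional `g` on words of length one. -/
def letterMul [Semiring R] (g : α → R) (B : List α → R) : List α → R
  | [] => 0
  | k :: u => g k * B u

section Conv

variable [Semiring R] (A A' B C : List α → R)

theorem conv_nil : conv A B [] = A [] * B [] := by simp [conv]

theorem conv_cons (k : α) (w : List α) :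
    conv A B (k :: w) = conv (fun v => A (k :: v)) B w + A [] * B (k :: w) := by
  simp [conv, Finset.sum_range_succ' _ (w.length + 1)]

theorem conv_add_left (w : List α) :
    conv (fun v => A v + A' v) B w = conv A B w + conv A' B w := by
  simp [conv, add_mul, Finset.sum_add_distrib]

theorem conv_add_right (w : List α) :
    conv A (fun v => B v + C v) w = conv A B w + conv A C w := by
  simp [conv, mul_add, Finset.sum_add_distrib]

theorem conv_mul_left (c : R) (w : List α) : conv (fun v => c * A v) B w = c * conv A B w := by
  simp [conv, Finset.mul_sum, mul_assoc]

theorem conv_sum_left {ι : Type*} (s : Finset ι) (A : ι → List α → R) (w : List α) :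
    conv (fun v => ∑ m ∈ s, A m v) B w = ∑ m ∈ s, conv (A m) B w := by
  simp only [conv, Finset.sum_mul]
  exact Finset.sum_comm

theorem conv_assoc (w : List α) : conv (conv A B) C w = conv A (conv B C) w := by
  induction w generalizing A with
  | nil => simp [conv_nil, mul_assoc]
  | cons k w ih =>
    rw [conv_cons, conv_cons A]
    simp only [conv_cons, conv_add_left, conv_mul_left, conv_nil, ih, mul_add, mul_assoc,
      add_assoc]

theorem conv_convOne (w : List α) : conv A convOne w = A w := by
  induction w generalizing A with
  | nil => simp [conv_nil, convOne]
  | cons k w ih => simp [conv_cons, ih, convOne]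

theorem convOne_conv (w : List α) : conv convOne A w = A w := by
  cases w with
  | nil => simp [conv_nil, convOne]
  | cons k w =>
    rw [conv_cons]
    simp [convOne, conv]

theorem conv_letterMul (g : α → R) (w : List α) :
    conv A (letterMul g B) w =
      ∑ i : Fin w.length, A (w.take i) * (g w[i] * B (w.drop (i + 1))) := by
  rw [conv, Finset.sum_range_succ, List.drop_length, letterMul, mul_zero, add_zero,
    Finset.sum_range]
  refine Finset.sum_congr rfl fun i _ => ?_
  rw [List.drop_eq_getElem_cons i.2, letterMul, Fin.getElem_fin]

end Conv

variable [CommSemiring R] (f : ℤ → α → R)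

theorem chain_nil (a b : ℤ) : chain f [] a b = 1 := rfl

theorem chain_cons (k : α) (w : List α) (a b : ℤ) :
    chain f (k :: w) a b = ∑ m ∈ Ioo a b, f m k * chain f w a m := rfl

theorem chain_of_le_add_one (w : List α) {a b : ℤ} (h : b ≤ a + 1) :
    chain f w a b = convOne w := by
  cases w with
  | nil => rfl
  | cons k w =>
    have hempty : Ioo a b = ∅ := by
      ext; simp only [Finset.mem_Ioo, Finset.notMem_empty, iff_false]; omega
    rw [chain_cons, hempty, Finset.sum_empty, convOne]

theorem chain_append_singleton (w : List α) (k : α) (a b : ℤ) :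
    chain f (w ++ [k]) a b = ∑ m ∈ Ioo a b, f m k * chain f w m b := by
  induction w generalizing b with
  | nil => simp [chain]
  | cons l w ih =>
    simp only [List.cons_append, chain_cons, ih, Finset.mul_sum, mul_left_comm (f _ l)]
    exact Finset.sum_comm' (by simp only [Finset.mem_Ioo]; omega)

theorem chain_neg (w : List α) (a b : ℤ) :
    chain (fun m => f (-m)) w a b = chain f w.reverse (-b) (-a) := by
  induction w generalizing b with
  | nil => rfl
  | cons k w ih =>
    rw [List.reverse_cons, chain_append_singleton, chain_cons]
    exact Finset.sum_bij' (fun m _ => -m) (fun m _ => -m) (by simp only [Finset.mem_Ioo]; omega)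
      (by simp only [Finset.mem_Ioo]; omega) (by simp) (by simp) fun m _ => by rw [ih]

theorem chain_sub (c : ℤ) (w : List α) (a b : ℤ) :
    chain (fun m => f (m - c)) w a b = chain f w (a - c) (b - c) := by
  induction w generalizing b with
  | nil => rfl
  | cons k w ih =>
    rw [chain_cons, chain_cons]
    exact Finset.sum_bij' (fun m _ => m - c) (fun m _ => m + c)
      (by simp only [Finset.mem_Ioo]; omega) (by simp only [Finset.mem_Ioo]; omega) (by simp)
      (by simp) fun m _ => by rw [ih]

variable {f} in
theorem chain_congr {g : ℤ → α → R} {a b : ℤ} (h : ∀ m ∈ Ioo a b, f m = g m) (w : List α) :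
    chain f w a b = chain g w a b := by
  induction w generalizing b with
  | nil => rfl
  | cons k w ih =>
    refine Finset.sum_congr rfl fun m hm => ?_
    rw [h m hm, ih fun n hn => h n ?_]
    simp only [Finset.mem_Ioo] at *
    omega

theorem map_chain {S : Type*} [CommSemiring S] (φ : R →+* S) (w : List α) (a b : ℤ) :
    φ (chain f w a b) = chain (fun m k => φ (f m k)) w a b := by
  induction w generalizing b with
  | nil => simp [chain]
  | cons k w ih => simp [chain, ih]

theorem sum_Ioo_eq_add {M : Type*} [AddCommMonoid M] (g : ℤ → M) {a n b : ℤ} (han : a ≤ n)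
    (hnb : n < b) : ∑ m ∈ Ioo a b, g m = ∑ m ∈ Ioo n b, g m + ∑ m ∈ Ioo a (n + 1), g m := by
  have hunion : Ioo a b = Ioo n b ∪ Ioo a (n + 1) := by
    ext; simp only [Finset.mem_Ioo, Finset.mem_union]; omega
  rw [hunion, Finset.sum_union]
  exact Finset.disjoint_left.2 fun x => by simp only [Finset.mem_Ioo]; omega

theorem chain_eq_conv (w : List α) {a n b : ℤ} (han : a ≤ n) (hnb : n < b) :
    chain f w a b = conv (chain f · n b) (chain f · a (n + 1)) w := by
  induction w generalizing b with
  | nil => simp [conv_nil, chain_nil]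
  | cons k w ih =>
    rw [conv_cons, chain_nil, one_mul, chain_cons, chain_cons, sum_Ioo_eq_add _ han hnb]
    simp only [chain_cons, conv_sum_left, conv_mul_left]
    congr 1
    exact Finset.sum_congr rfl fun m hm => by rw [ih (Finset.mem_Ioo.1 hm).1]

theorem chain_add_one (w : List α) {a n : ℤ} (h : a < n) :
    chain f w a (n + 1) = chain f w a n + letterMul (f n) (chain f · a n) w := by
  cases w with
  | nil => simp [chain_nil, letterMul]
  | cons k w =>
    have hinsert : Ioo a (n + 1) = insert n (Ioo a n) := by
      ext; simp only [Finset.mem_Ioo, Finset.mem_insert]; omega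
    rw [chain_cons, hinsert, Finset.sum_insert (by simp), add_comm, letterMul, chain_cons]

theorem chain_split (w : List α) {a n b : ℤ} (han : a < n) (hnb : n < b) :
    chain f w a b = conv (chain f · n b) (chain f · a n) w +
      ∑ i : Fin w.length, chain f (w.take i) n b * (f n w[i] * chain f (w.drop (i + 1)) a n) := by
  simp only [chain_eq_conv f w han.le hnb, chain_add_one f _ han, conv_add_right, conv_letterMul]

end Chain

section Words

/-- The words of exponents `k d, …, k 1` whose series converge: all letters are positive, and the
head, if any, is at least `2`. -/
def AdmissibleWord (w : List ℕ) : Prop := (∀ x ∈ w, 1 ≤ x) ∧ ∀ x ∈ w.head?, 2 ≤ x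

theorem admissibleWord_nil : AdmissibleWord [] := by simp [AdmissibleWord]

theorem admissibleWord_cons {k : ℕ} {w : List ℕ} :
    AdmissibleWord (k :: w) ↔ 2 ≤ k ∧ ∀ x ∈ w, 1 ≤ x := by
  simp only [AdmissibleWord, List.mem_cons, forall_eq_or_imp, List.head?_cons,
    Option.mem_some_iff, forall_eq']
  exact ⟨fun h => ⟨h.2, h.1.2⟩, fun h => ⟨⟨by lia, h.2⟩, h.1⟩⟩

theorem AdmissibleWord.take {w : List ℕ} (hw : AdmissibleWord w) (i : ℕ) :
    AdmissibleWord (w.take i) := by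
  refine ⟨fun x hx => hw.1 x (List.mem_of_mem_take hx), ?_⟩
  rcases i with _ | i <;> rcases w with _ | ⟨k, w⟩ <;> simp_all [admissibleWord_cons]

theorem pos_of_forall₂_le {w w' : List ℕ} (h : List.Forall₂ (· ≤ ·) w w')
    (hw : ∀ x ∈ w, 1 ≤ x) : ∀ x ∈ w', 1 ≤ x := by
  induction h with
  | nil => simp
  | cons hle _ ih =>
    simp only [List.mem_cons, forall_eq_or_imp] at hw ⊢
    exact ⟨hw.1.trans hle, ih hw.2⟩

theorem AdmissibleWord.of_forall₂_le {w w' : List ℕ} (h : List.Forall₂ (· ≤ ·) w w')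
    (hw : AdmissibleWord w) : AdmissibleWord w' := by
  cases h with
  | nil => exact hw
  | cons hle h =>
    rw [admissibleWord_cons] at hw ⊢
    exact ⟨hw.1.trans hle, pos_of_forall₂_le h hw.2⟩

/-- The quasi-shuffles of two words. -/
def stuffle : List ℕ → List ℕ → List (List ℕ)
  | [], v => [v]
  | k :: u, [] => [k :: u]
  | k :: u, l :: v => (stuffle u (l :: v)).map (k :: ·) ++ (stuffle (k :: u) v).map (l :: ·) ++
      (stuffle u v).map ((k + l) :: ·)
  termination_by u v => u.length + v.length

theorem length_le_of_mem_stuffle {u v c : List ℕ} (hc : c ∈ stuffle u v) :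
    c.length ≤ u.length + v.length := by
  induction u, v using stuffle.induct generalizing c with
  | case1 v => simp_all [stuffle]
  | case2 k u => simp_all [stuffle]
  | case3 k u l v ih₁ ih₂ ih₃ =>
    simp only [stuffle, List.mem_append, List.mem_map] at hc
    simp only [List.length_cons] at *
    obtain (⟨c, h, rfl⟩ | ⟨c, h, rfl⟩) | ⟨c, h, rfl⟩ := hc <;> grind

theorem pos_of_mem_stuffle {u v c : List ℕ} (hu : ∀ x ∈ u, 1 ≤ x) (hv : ∀ x ∈ v, 1 ≤ x)
    (hc : c ∈ stuffle u v) : ∀ x ∈ c, 1 ≤ x := by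
  induction u, v using stuffle.induct generalizing c with
  | case1 v => simp_all [stuffle]
  | case2 k u => simp_all [stuffle]
  | case3 k u l v ih₁ ih₂ ih₃ =>
    simp only [stuffle, List.mem_append, List.mem_map] at hc
    simp only [List.forall_mem_cons] at *
    obtain (⟨c, h, rfl⟩ | ⟨c, h, rfl⟩) | ⟨c, h, rfl⟩ := hc
    · exact List.forall_mem_cons.2 ⟨hu.1, ih₁ hu.2 hv h⟩
    · exact List.forall_mem_cons.2 ⟨hv.1, ih₂ hu hv.2 h⟩
    · exact List.forall_mem_cons.2 ⟨by lia, ih₃ hu.2 hv.2 h⟩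

theorem AdmissibleWord.of_mem_stuffle {u v c : List ℕ} (hu : AdmissibleWord u)
    (hv : AdmissibleWord v) (hc : c ∈ stuffle u v) : AdmissibleWord c := by
  refine ⟨pos_of_mem_stuffle hu.1 hv.1 hc, ?_⟩
  rcases u with _ | ⟨k, u⟩
  · simp_all [stuffle, AdmissibleWord]
  rcases v with _ | ⟨l, v⟩
  · simp_all [stuffle, AdmissibleWord]
  rw [admissibleWord_cons] at hu hv
  simp only [stuffle, List.mem_append, List.mem_map] at hc
  obtain (⟨c, -, rfl⟩ | ⟨c, -, rfl⟩) | ⟨c, -, rfl⟩ := hc <;>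
    simp only [List.head?_cons, Option.mem_some_iff, forall_eq'] <;> lia

/-- The words other than `1 ^ (s + 1) ++ v` in the quasi-shuffle product of the word `[1]` with
`1 ^ s ++ v`; each has at most `s` leading ones. -/
def harmonicRemainder : ℕ → List ℕ → List (List ℕ)
  | 0, [] => []
  | 0, k :: v => (stuffle [1] v).map (k :: ·) ++ [(k + 1) :: v]
  | s + 1, v => (harmonicRemainder s v).map (1 :: ·) ++ [2 :: (List.replicate s 1 ++ v)]

theorem exists_of_mem_harmonicRemainder {s : ℕ} {v c : List ℕ} (hv : AdmissibleWord v)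
    (hc : c ∈ harmonicRemainder s v) : ∃ i x, c = List.replicate i 1 ++ x ∧ i ≤ s ∧
      AdmissibleWord x ∧ i + x.length ≤ s + 1 + v.length := by
  induction s generalizing c with
  | zero =>
    cases v with
    | nil => simp [harmonicRemainder] at hc
    | cons k v =>
      rw [admissibleWord_cons] at hv
      simp only [harmonicRemainder, List.mem_append, List.mem_map, List.mem_singleton] at hc
      obtain ⟨c, h, rfl⟩ | rfl := hc
      · have hlen := length_le_of_mem_stuffle h
        exact ⟨0, k :: c, rfl, le_rfl,
          admissibleWord_cons.2 ⟨hv.1, pos_of_mem_stuffle (by simp) hv.2 h⟩,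
          by simp only [List.length_cons, List.length_nil] at *; lia⟩
      · exact ⟨0, _, rfl, le_rfl, admissibleWord_cons.2 ⟨by lia, hv.2⟩, by simp⟩
  | succ s ih =>
    simp only [harmonicRemainder, List.mem_append, List.mem_map, List.mem_singleton] at hc
    obtain ⟨c, hc, rfl⟩ | rfl := hc
    · obtain ⟨i, x, rfl, hi, hx, hlen⟩ := ih hc
      exact ⟨i + 1, x, rfl, by lia, hx, by lia⟩
    · have hpos : ∀ x ∈ List.replicate s 1 ++ v, 1 ≤ x := by
        simp only [List.mem_append, List.mem_replicate]
        rintro x (⟨-, rfl⟩ | hx)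
        exacts [le_rfl, hv.1 x hx]
      exact ⟨0, _, rfl, by lia, admissibleWord_cons.2 ⟨le_rfl, hpos⟩, by simp⟩

/-- The words, at most one, obtained by adding a letter to the head of a word. -/
def addToHead (k : ℕ) : List ℕ → List (List ℕ)
  | [] => []
  | l :: c => [(k + l) :: c]

theorem length_eq_of_mem_addToHead {k : ℕ} {c c' : List ℕ} (h : c' ∈ addToHead k c) :
    c'.length = c.length := by
  cases c <;> simp_all [addToHead]

theorem pos_of_mem_addToHead {k : ℕ} {c c' : List ℕ} (hc : ∀ x ∈ c, 1 ≤ x)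
    (h : c' ∈ addToHead k c) : ∀ x ∈ c', 1 ≤ x := by
  cases c with
  | nil => simp [addToHead] at h
  | cons l c =>
    rw [addToHead, List.mem_singleton] at h
    rw [List.forall_mem_cons] at hc
    exact h ▸ List.forall_mem_cons.2 ⟨by lia, hc.2⟩

/-- The words obtained by adding up consecutive letters of a word, excluding the word itself. -/
def properMergings : List ℕ → List (List ℕ)
  | [] => []
  | k :: w => addToHead k w ++ (properMergings w).flatMap fun c => (k :: c) :: addToHead k c

theorem length_lt_of_mem_properMergings {w c : List ℕ} (h : c ∈ properMergings w) :
    c.length < w.length := by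
  induction w generalizing c with
  | nil => simp [properMergings] at h
  | cons k w ih =>
    simp only [properMergings, List.mem_append, List.mem_flatMap, List.mem_cons] at h
    rw [List.length_cons]
    obtain h | ⟨c', h', rfl | h⟩ := h
    · exact Nat.lt_succ_of_le (length_eq_of_mem_addToHead h).le
    · simpa using ih h'
    · rw [length_eq_of_mem_addToHead h]
      exact (ih h').trans (Nat.lt_succ_self _)

theorem pos_of_mem_properMergings {w c : List ℕ} (hw : ∀ x ∈ w, 1 ≤ x)
    (h : c ∈ properMergings w) : ∀ x ∈ c, 1 ≤ x := by
  induction w generalizing c with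
  | nil => simp [properMergings] at h
  | cons k w ih =>
    simp only [properMergings, List.mem_append, List.mem_flatMap, List.mem_cons] at h
    rw [List.forall_mem_cons] at hw
    obtain h | ⟨c', h', rfl | h⟩ := h
    · exact pos_of_mem_addToHead hw.2 h
    · exact List.forall_mem_cons.2 ⟨hw.1, ih hw.2 h'⟩
    · exact pos_of_mem_addToHead (ih hw.2 h') h

end Words

section TruncatedSums

/-- The function `m ↦ m ^ (-k)`. -/
noncomputable def powInv (m : ℤ) (k : ℕ) : ℝ := ((m : ℝ) ^ k)⁻¹

/-- The truncated multiple zeta value (multiple harmonic sum), a sum over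
`0 < m_1 < ⋯ < m_d < N`. -/
noncomputable def mhs (w : List ℕ) (N : ℕ) : ℝ := chain powInv w 0 N

theorem powInv_neg (m : ℤ) (k : ℕ) : powInv (-m) k = (-1) ^ k * powInv m k := by
  rw [powInv, powInv, Int.cast_neg, neg_pow, mul_inv, ← inv_pow, inv_neg_one]

theorem sum_Ioo_zero_natCast {M : Type*} [AddCommMonoid M] (g : ℤ → M) (N : ℕ) :
    ∑ m ∈ Ioo (0 : ℤ) N, g m = ∑ m ∈ Ico 1 N, g m :=
  Finset.sum_bij' (fun m _ => m.toNat) (fun m _ => m)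
    (by simp only [Finset.mem_Ioo, Finset.mem_Ico]; lia)
    (by simp only [Finset.mem_Ioo, Finset.mem_Ico]; lia)
    (by simp only [Finset.mem_Ioo]; lia) (by simp) fun m hm => by
      rw [Int.toNat_of_nonneg (Finset.mem_Ioo.1 hm).1.le]

theorem mhs_nil (N : ℕ) : mhs [] N = 1 := rfl

theorem mhs_cons (k : ℕ) (w : List ℕ) (N : ℕ) :
    mhs (k :: w) N = ∑ m ∈ Ico 1 N, ((m : ℝ) ^ k)⁻¹ * mhs w m := by
  rw [mhs, chain_cons, sum_Ioo_zero_natCast]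
  simp [powInv, mhs]

theorem mhs_cons_succ (k : ℕ) (w : List ℕ) {N : ℕ} (hN : 1 ≤ N) :
    mhs (k :: w) (N + 1) = mhs (k :: w) N + ((N : ℝ) ^ k)⁻¹ * mhs w N := by
  rw [mhs_cons, mhs_cons, Finset.sum_Ico_succ_top hN]

theorem chain_powInv_neg (w : List ℕ) (a b : ℤ) :
    chain (fun m => powInv (-m)) w a b = (-1) ^ w.sum * chain powInv w a b := by
  induction w generalizing b with
  | nil => simp [chain]
  | cons k w ih =>
    rw [chain_cons, chain_cons, Finset.mul_sum]
    refine Finset.sum_congr rfl fun m _ => ?_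
    rw [ih, powInv_neg, List.sum_cons, pow_add]
    ring

theorem chain_powInv_neg_zero (u : List ℕ) (A : ℕ) :
    chain powInv u (-A) 0 = (-1) ^ u.sum * mhs u.reverse A := by
  have hneg := chain_neg powInv u.reverse 0 A
  rw [List.reverse_reverse, neg_zero] at hneg
  rw [← hneg, chain_powInv_neg, List.sum_reverse, mhs]

theorem sum_Ico_mul_sum_Ico {R : Type*} [CommRing R] (a b : ℕ → R) (N : ℕ) :
    (∑ m ∈ Ico 1 N, a m) * ∑ m ∈ Ico 1 N, b m =
      ∑ m ∈ Ico 1 N, a m * (∑ n ∈ Ico 1 m, b n) + ∑ m ∈ Ico 1 N, b m * (∑ n ∈ Ico 1 m, a n) +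
      ∑ m ∈ Ico 1 N, a m * b m := by
  induction N with
  | zero => simp
  | succ N ih =>
    rcases Nat.eq_zero_or_pos N with rfl | hN
    · simp
    · simp only [Finset.sum_Ico_succ_top hN]
      linear_combination ih

theorem sum_map_mhs_cons (k : ℕ) (T : List (List ℕ)) (N : ℕ) :
    ((T.map (k :: ·)).map (mhs · N)).sum =
      ∑ m ∈ Ico 1 N, ((m : ℝ) ^ k)⁻¹ * (T.map (mhs · m)).sum := by
  induction T with
  | nil => simp
  | cons c T ih => simp [mul_add, Finset.sum_add_distrib, ← mhs_cons, ← ih]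

theorem mhs_cons_mul_cons (k : ℕ) (u : List ℕ) (l : ℕ) (v : List ℕ) (N : ℕ) :
    mhs (k :: u) N * mhs (l :: v) N =
      ∑ m ∈ Ico 1 N, ((m : ℝ) ^ k)⁻¹ * (mhs u m * mhs (l :: v) m) +
      ∑ m ∈ Ico 1 N, ((m : ℝ) ^ l)⁻¹ * (mhs (k :: u) m * mhs v m) +
      ∑ m ∈ Ico 1 N, ((m : ℝ) ^ (k + l))⁻¹ * (mhs u m * mhs v m) := by
  rw [mhs_cons, mhs_cons, sum_Ico_mul_sum_Ico]
  simp only [← mhs_cons, pow_add, mul_inv]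
  congr 1
  · congr 1 <;> exact Finset.sum_congr rfl fun m _ => by ring
  · exact Finset.sum_congr rfl fun m _ => by ring

theorem mhs_mul (u v : List ℕ) (N : ℕ) :
    mhs u N * mhs v N = ((stuffle u v).map (mhs · N)).sum := by
  induction u, v using stuffle.induct generalizing N with
  | case1 v => simp [stuffle, mhs_nil]
  | case2 k u => simp [stuffle, mhs_nil]
  | case3 k u l v ih₁ ih₂ ih₃ =>
    rw [stuffle, mhs_cons_mul_cons]
    simp only [ih₁, ih₂, ih₃, ← sum_map_mhs_cons, List.map_append, List.sum_append]

theorem mhs_one_mul_mhs_ones_append (s : ℕ) (v : List ℕ) (N : ℕ) :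
    mhs [1] N * mhs (List.replicate s 1 ++ v) N =
      (s + 1) * mhs (List.replicate (s + 1) 1 ++ v) N +
        ((harmonicRemainder s v).map (mhs · N)).sum := by
  induction s generalizing N with
  | zero =>
    cases v with
    | nil => simp [harmonicRemainder, mhs_nil]
    | cons k v =>
      rw [List.replicate_zero, List.nil_append, zero_add, List.replicate_one,
        List.singleton_append, mhs_cons_mul_cons]
      simp only [harmonicRemainder, mhs_mul [1] v, ← sum_map_mhs_cons, mhs_nil, one_mul,
        ← mhs_cons, List.map_append, List.sum_append, List.map_singleton, List.sum_singleton,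
        add_comm 1 k]
      push_cast
      ring
  | succ s ih =>
    rw [List.replicate_succ, List.cons_append, mhs_cons_mul_cons]
    simp only [ih, mhs_nil, one_mul, ← mhs_cons, harmonicRemainder, List.map_append,
      List.sum_append, sum_map_mhs_cons, List.map_singleton, List.sum_singleton, mul_add,
      Finset.sum_add_distrib, mul_left_comm _ ((s : ℝ) + 1), ← Finset.mul_sum,
      List.replicate_succ, List.cons_append]
    push_cast
    ring

/-- The truncated multiple zeta star value, a sum over `0 < m_1 ≤ ⋯ ≤ m_d < N`. -/
noncomputable def mhsStar : List ℕ → ℕ → ℝ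
  | [], _ => 1
  | k :: w, N => ∑ m ∈ Ico 1 N, ((m : ℝ) ^ k)⁻¹ * mhsStar w (m + 1)

theorem sum_mhs_succ (k : ℕ) (c : List ℕ) (N : ℕ) :
    ∑ m ∈ Ico 1 N, ((m : ℝ) ^ k)⁻¹ * mhs c (m + 1) =
      mhs (k :: c) N + ((addToHead k c).map (mhs · N)).sum := by
  cases c with
  | nil => simp [addToHead, mhs_cons, mhs_nil]
  | cons l c =>
    rw [addToHead, List.map_singleton, List.sum_singleton, mhs_cons, mhs_cons,
      ← Finset.sum_add_distrib]
    refine Finset.sum_congr rfl fun m hm => ?_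
    rw [mhs_cons_succ _ _ (Finset.mem_Ico.1 hm).1, pow_add, mul_inv]
    ring

theorem sum_map_mhs_succ (k : ℕ) (T : List (List ℕ)) (N : ℕ) :
    ∑ m ∈ Ico 1 N, ((m : ℝ) ^ k)⁻¹ * (T.map (mhs · (m + 1))).sum =
      ((T.flatMap fun c => (k :: c) :: addToHead k c).map (mhs · N)).sum := by
  induction T with
  | nil => simp
  | cons c T ih =>
    simp only [List.map_cons, List.sum_cons, mul_add, Finset.sum_add_distrib, sum_mhs_succ, ih,
      List.flatMap_cons, List.map_append, List.sum_append]

theorem mhsStar_eq (w : List ℕ) (N : ℕ) :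
    mhsStar w N = mhs w N + ((properMergings w).map (mhs · N)).sum := by
  induction w generalizing N with
  | nil => simp [mhsStar, properMergings, mhs_nil]
  | cons k w ih =>
    simp only [mhsStar, ih, mul_add, Finset.sum_add_distrib, sum_mhs_succ, sum_map_mhs_succ,
      properMergings, List.map_append, List.sum_append, add_assoc]

/-- The inverse, for the convolution product, of the chain sums over `(-N, 0)`. -/
noncomputable def negInv (N : ℕ) (u : List ℕ) : ℝ := (-1) ^ (u.length + u.sum) * mhsStar u N

theorem negInv_succ {N : ℕ} (hN : 1 ≤ N) (w : List ℕ) :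
    negInv (N + 1) w + letterMul (powInv (-N)) (negInv (N + 1)) w = negInv N w := by
  cases w with
  | nil => simp [letterMul, negInv, mhsStar]
  | cons k w =>
    rw [letterMul, powInv_neg]
    simp only [negInv, mhsStar, Finset.sum_Ico_succ_top hN, powInv, List.length_cons,
      List.sum_cons, Int.cast_natCast, pow_add, pow_one]
    ring

theorem letterMul_convOne_conv (g : ℕ → ℝ) (B : List ℕ → ℝ) (w : List ℕ) :
    conv (letterMul g convOne) B w = letterMul g B w := by
  cases w with
  | nil => simp [conv_nil, letterMul]
  | cons k w => simp [conv_cons, letterMul, conv_mul_left, convOne_conv]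

theorem chain_neg_succ (u : List ℕ) (N : ℕ) (hN : 1 ≤ N) :
    chain powInv u (-(N + 1 : ℕ)) 0 = conv (fun u => chain powInv u (-N) 0)
      (fun u => convOne u + letterMul (powInv (-N)) convOne u) u := by
  have hempty (v : List ℕ) : chain powInv v (-(N + 1 : ℕ)) (-N) = convOne v :=
    chain_of_le_add_one _ _ (by lia)
  rw [chain_eq_conv (n := -N) _ _ (by lia) (by lia)]
  simp only [chain_add_one powInv _ (show -((N + 1 : ℕ) : ℤ) < -N by lia), hempty]

theorem conv_chain_negInv {N : ℕ} (hN : 1 ≤ N) (w : List ℕ) :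
    conv (fun u => chain powInv u (-N) 0) (negInv N) w = convOne w := by
  induction N, hN using Nat.le_induction generalizing w with
  | base =>
    simp only [chain_of_le_add_one powInv _ (show (0 : ℤ) ≤ -(1 : ℕ) + 1 by lia)]
    rw [convOne_conv]
    cases w <;> simp [negInv, mhsStar, convOne]
  | succ N hN ih =>
    simp only [chain_neg_succ _ N hN]
    rw [conv_assoc, ← ih w]
    congr 1
    funext u
    rw [conv_add_left, convOne_conv, letterMul_convOne_conv, negInv_succ hN]

theorem mhs_eq_conv {N : ℕ} (hN : 1 ≤ N) (w : List ℕ) :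
    mhs w N = conv (conv (mhs · N) (fun u => chain powInv u (-N) 0)) (negInv N) w := by
  rw [conv_assoc, funext (conv_chain_negInv hN), conv_convOne]

end TruncatedSums

section Residues

open HahnSeries (single ofPowerSeries)

variable {K : Type*} [Field K]

/-- The residue at `0` of a formal Laurent series. -/
def residue : LaurentSeries K →ₗ[K] K := HahnSeries.coeff.linearMap (-1)

/-- The Laurent series `(X + a)⁻¹`. -/
noncomputable def invLin (a : K) : LaurentSeries K := (single 1 1 + HahnSeries.C a)⁻¹

/-- The power series `(X + a)⁻¹`, for `a ≠ 0`. -/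
noncomputable def invLinPS (a : K) : PowerSeries K :=
  PowerSeries.mk fun j => (-1) ^ j * (a ^ (j + 1))⁻¹

theorem X_add_C_ne_zero (a : K) : (single (1 : ℤ) 1 + HahnSeries.C a : LaurentSeries K) ≠ 0 := by
  intro h
  simpa [HahnSeries.C_apply, HahnSeries.coeff_single_of_ne] using
    congrArg (fun y : LaurentSeries K => y.coeff 1) h

theorem invLin_mul_invLin {a b : K} (h : a ≠ b) :
    invLin a * invLin b = HahnSeries.C (b - a)⁻¹ * (invLin a - invLin b) := by
  have ha := X_add_C_ne_zero a
  have hb := X_add_C_ne_zero b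
  have hdiff : invLin a - invLin b = HahnSeries.C (b - a) * (invLin a * invLin b) := by
    rw [invLin, invLin, map_sub]
    field_simp
    ring
  rw [hdiff, ← mul_assoc, ← map_mul, inv_mul_cancel₀ (sub_ne_zero.2 h.symm), map_one, one_mul]

theorem X_add_C_mul_invLinPS {a : K} (ha : a ≠ 0) :
    (PowerSeries.X + PowerSeries.C a) * invLinPS a = 1 := by
  ext j
  rw [add_mul, map_add, PowerSeries.coeff_C_mul]
  cases j with
  | zero => simp [invLinPS, ha]
  | succ j =>
    rw [PowerSeries.coeff_succ_X_mul, invLinPS, PowerSeries.coeff_mk, PowerSeries.coeff_mk,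
      PowerSeries.coeff_one, if_neg (Nat.succ_ne_zero _)]
    field_simp
    ring

theorem invLin_eq_ofPowerSeries {a : K} (ha : a ≠ 0) :
    invLin a = ofPowerSeries ℤ K (invLinPS a) := by
  rw [invLin, inv_eq_iff_eq_inv]
  refine eq_inv_of_mul_eq_one_left ?_
  rw [← HahnSeries.ofPowerSeries_X, ← HahnSeries.ofPowerSeries_C, ← map_add, ← map_mul,
    X_add_C_mul_invLinPS ha, map_one]

theorem coeff_invLinPS_pow (a : K) (k j : ℕ) :
    PowerSeries.coeff j (invLinPS a ^ k) = (-1) ^ j * k.multichoose j * (a ^ (k + j))⁻¹ := by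
  rcases eq_or_ne a 0 with rfl | ha
  · have hzero : invLinPS (0 : K) = 0 := by ext; simp [invLinPS]
    rcases k with _ | k <;> rcases j with _ | j <;> simp [hzero, PowerSeries.coeff_one]
  induction k generalizing j with
  | zero => rcases j with _ | j <;> simp [PowerSeries.coeff_one]
  | succ k ihk =>
    have hrec : (PowerSeries.X + PowerSeries.C a) * invLinPS a ^ (k + 1) = invLinPS a ^ k := by
      rw [pow_succ', ← mul_assoc, X_add_C_mul_invLinPS ha, one_mul]
    have hcoeff := fun j => congrArg (PowerSeries.coeff j) hrec
    simp only [add_mul, map_add, PowerSeries.coeff_C_mul, ihk] at hcoeff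
    refine mul_left_cancel₀ ha ?_
    induction j with
    | zero =>
      have hzero := hcoeff 0
      rw [PowerSeries.coeff_zero_X_mul, zero_add] at hzero
      rw [hzero]
      simp [pow_succ, mul_comm, ha]
    | succ j ihj =>
      have := hcoeff (j + 1)
      rw [PowerSeries.coeff_succ_X_mul, mul_left_cancel₀ ha ihj] at this
      rw [eq_sub_of_add_eq' this, Nat.multichoose_succ_succ]
      push_cast
      field_simp
      ring

theorem invLin_zero_pow (k : ℕ) : invLin (0 : K) ^ k = single (-(k : ℤ)) 1 := by
  simp [invLin, HahnSeries.single_pow]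

theorem residue_ofPowerSeries (p : PowerSeries K) : residue (ofPowerSeries ℤ K p) = 0 := by
  simpa [residue] using PowerSeries.coeff_coe p (-1)

theorem residue_invLin_zero_pow_mul (k : ℕ) (p : PowerSeries K) :
    residue (invLin 0 ^ (k + 1) * ofPowerSeries ℤ K p) = PowerSeries.coeff k p := by
  have hcoeff := HahnSeries.coeff_single_mul_add (r := (1 : K)) (x := ofPowerSeries ℤ K p)
    (a := (k : ℤ)) (b := -((k + 1 : ℕ) : ℤ))
  rw [show (k : ℤ) + -((k + 1 : ℕ) : ℤ) = -1 by push_cast; ring, one_mul,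
    HahnSeries.ofPowerSeries_apply_coeff] at hcoeff
  rw [invLin_zero_pow]
  exact hcoeff

theorem residue_invLin_pow (a : K) {k : ℕ} (hk : k ≠ 1) : residue (invLin a ^ k) = 0 := by
  rcases eq_or_ne a 0 with rfl | ha
  · rw [invLin_zero_pow]
    exact HahnSeries.coeff_single_of_ne (by lia)
  · rw [invLin_eq_ofPowerSeries ha, ← map_pow, residue_ofPowerSeries]

theorem sum_residue_invLin {S : Finset K} {a : K} (ha : a ∈ S) :
    ∑ c ∈ S, residue (invLin (a - c)) = 1 := by
  rw [Finset.sum_eq_single_of_mem a ha]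
  · simpa using residue_invLin_zero_pow_mul 0 (1 : PowerSeries K)
  · intro b _ hb
    rw [invLin_eq_ofPowerSeries (sub_ne_zero.2 hb.symm), residue_ofPowerSeries]

theorem sum_residue_prod_invLin (S : Finset K) (s : Multiset K) (hS : ∀ p ∈ s, p ∈ S) :
    ∑ c ∈ S, residue (s.map fun p => invLin (p - c)).prod = if s.card = 1 then 1 else 0 := by
  induction hn : s.card generalizing s with
  | zero =>
    have hone : residue (1 : LaurentSeries K) = 0 := by
      simpa using residue_invLin_pow (0 : K) zero_ne_one
    simp [Multiset.card_eq_zero.1 hn, hone]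
  | succ n ih =>
    obtain ⟨a, ha⟩ : ∃ a, a ∈ s := Multiset.card_pos_iff_exists_mem.1 (by lia)
    by_cases hall : ∀ b ∈ s, b = a
    · obtain rfl : s = Multiset.replicate (n + 1) a := Multiset.eq_replicate.2 ⟨hn, hall⟩
      simp only [Multiset.map_replicate, Multiset.prod_replicate]
      rcases eq_or_ne n 0 with rfl | hn0
      · simpa using sum_residue_invLin (hS a ha)
      · rw [if_neg (by lia)]
        exact Finset.sum_eq_zero fun c _ => residue_invLin_pow _ (by lia)
    · push Not at hall
      obtain ⟨b, hb, hba⟩ := hall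
      obtain ⟨t, rfl⟩ := Multiset.exists_cons_of_mem ha
      obtain ⟨t, rfl⟩ := Multiset.exists_cons_of_mem ((Multiset.mem_cons.1 hb).resolve_left hba)
      have hpartial (c : K) : residue ((a ::ₘ b ::ₘ t).map fun p => invLin (p - c)).prod =
          (b - a)⁻¹ * (residue ((a ::ₘ t).map fun p => invLin (p - c)).prod -
            residue ((b ::ₘ t).map fun p => invLin (p - c)).prod) := by
        simp only [Multiset.map_cons, Multiset.prod_cons]
        rw [← mul_assoc, invLin_mul_invLin (sub_left_injective.ne hba.symm),
          sub_sub_sub_cancel_right, mul_assoc, HahnSeries.C_mul_eq_smul, map_smul, sub_mul, map_sub,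
          smul_eq_mul]
      simp only [Multiset.forall_mem_cons] at hS
      rw [Multiset.card_cons, Multiset.card_cons] at hn
      simp only [hpartial, ← Finset.mul_sum, Finset.sum_sub_distrib]
      rw [ih _ (by simpa using ⟨hS.1, hS.2.2⟩) (by simp; lia),
        ih _ (by simpa using hS.2) (by simp; lia), sub_self, mul_zero, if_neg (by lia)]

theorem sum_residue_chain_mul_prod (S : Finset K) (w : List ℕ) (s : Multiset K)
    (hs : 2 ≤ w.sum + s.card) (hS : ∀ p ∈ s, p ∈ S) (a b : ℤ) (hab : ∀ m ∈ Ioo a b, (m : K) ∈ S) :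
    ∑ c ∈ S, residue (chain (fun m k => invLin (m - c) ^ k) w a b *
      (s.map fun p => invLin (p - c)).prod) = 0 := by
  induction w generalizing b s with
  | nil =>
    rw [List.sum_nil, zero_add] at hs
    simp only [chain_nil, one_mul]
    rw [sum_residue_prod_invLin S s hS, if_neg (by lia)]
  | cons k w ih =>
    simp only [chain_cons, Finset.sum_mul, map_sum]
    rw [Finset.sum_comm]
    refine Finset.sum_eq_zero fun m hm => ?_
    rw [← ih (Multiset.replicate k (m : K) + s) (by simp at *; lia) ?_ m ?_]
    · refine Finset.sum_congr rfl fun c _ => ?_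
      simp only [Multiset.map_add, Multiset.map_replicate, Multiset.prod_add,
        Multiset.prod_replicate, mul_comm, mul_left_comm, mul_assoc]
    · intro p hp
      obtain h | h := Multiset.mem_add.1 hp
      · exact Multiset.eq_of_mem_replicate h ▸ hab m hm
      · exact hS p h
    · intro x hx
      refine hab x ?_
      simp only [Finset.mem_Ioo] at *
      lia

end Residues

section GapCoefficients

open HahnSeries (ofPowerSeries)

/-- The Taylor series at `0` of the sum of `∏ (X + n i) ^ (-k i)` over `a < n 1 < ⋯ < n d < b`. It
is only meaningful if `0` does not lie strictly between `a` and `b`. -/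
noncomputable def chainPS (w : List ℕ) (a b : ℤ) : PowerSeries ℝ :=
  chain (fun m k => invLinPS (m : ℝ) ^ k) w a b

/-- The chain sums, as functions of the interval, of the words that dominate `w` entrywise. -/
def dominating (w : List ℕ) : Set (ℤ → ℤ → ℝ) :=
  {g | ∃ v, List.Forall₂ (· ≤ ·) w v ∧ g = chain powInv v}

/-- Prepending a letter, as a linear map on functions of intervals: it maps the chain sum of `w`
to that of `k :: w`. -/
noncomputable def prependLetter (k : ℕ) : (ℤ → ℤ → ℝ) →ₗ[ℚ] (ℤ → ℤ → ℝ) where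
  toFun g a b := ∑ m ∈ Ioo a b, powInv m k * g a m
  map_add' g h := by ext a b; simp [mul_add, Finset.sum_add_distrib]
  map_smul' c g := by
    ext a b
    simp only [Pi.smul_apply, RingHom.id_apply, Finset.smul_sum, mul_smul_comm]

theorem prependLetter_mem_span_dominating {k l : ℕ} (hkl : k ≤ l) {w : List ℕ} {g : ℤ → ℤ → ℝ}
    (hg : g ∈ Submodule.span ℚ (dominating w)) :
    prependLetter l g ∈ Submodule.span ℚ (dominating (k :: w)) := by
  refine Submodule.span_mono ?_ (Submodule.apply_mem_span_image_of_mem_span (prependLetter l) hg)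
  rintro _ ⟨_, ⟨w', hw', rfl⟩, rfl⟩
  exact ⟨l :: w', List.Forall₂.cons hkl hw', rfl⟩

theorem coeff_chainPS_cons (k : ℕ) (w : List ℕ) (j : ℕ) :
    (fun a b => PowerSeries.coeff j (chainPS (k :: w) a b)) =
      ∑ p ∈ antidiagonal j, ((-1) ^ p.1 * k.multichoose p.1 : ℚ) •
        prependLetter (k + p.1) (fun a b => PowerSeries.coeff p.2 (chainPS w a b)) := by
  ext a b
  simp only [chainPS, chain_cons, map_sum, PowerSeries.coeff_mul, coeff_invLinPS_pow,
    prependLetter, LinearMap.coe_mk, AddHom.coe_mk, Finset.sum_apply, Pi.smul_apply,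
    Finset.smul_sum, powInv, Rat.smul_def]
  rw [Finset.sum_comm]
  refine Finset.sum_congr rfl fun p _ => Finset.sum_congr rfl fun m _ => ?_
  push_cast
  ring

theorem coeff_chainPS_mem_span (w : List ℕ) (j : ℕ) :
    (fun a b => PowerSeries.coeff j (chainPS w a b)) ∈ Submodule.span ℚ (dominating w) := by
  induction w generalizing j with
  | nil =>
    have hone : chain powInv [] ∈ Submodule.span ℚ (dominating []) :=
      Submodule.subset_span ⟨[], List.Forall₂.nil, rfl⟩
    convert Submodule.smul_mem _ (if j = 0 then (1 : ℚ) else 0) hone using 1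
    ext a b
    rw [chainPS, chain_nil, PowerSeries.coeff_one, Pi.smul_apply, Pi.smul_apply, chain_nil]
    split_ifs <;> simp
  | cons k w ih =>
    rw [coeff_chainPS_cons]
    exact Submodule.sum_mem _ fun p _ => Submodule.smul_mem _ _
      (prependLetter_mem_span_dominating (Nat.le_add_right k p.1) (ih p.2))

theorem constantCoeff_chainPS (w : List ℕ) (a b : ℤ) :
    PowerSeries.constantCoeff (chainPS w a b) = chain powInv w a b := by
  rw [chainPS, map_chain]
  congr 1
  ext m k
  rw [← PowerSeries.coeff_zero_eq_constantCoeff_apply, coeff_invLinPS_pow]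
  simp [powInv]

/-- The products of a truncated sum up to `B` and a truncated sum up to `A`, of total depth `d`,
the first one being convergent. -/
def twoSided (d : ℕ) : Set (ℕ → ℕ → ℝ) :=
  {g | ∃ v u : List ℕ, v.length + u.length = d ∧ AdmissibleWord v ∧ (∀ x ∈ u, 1 ≤ x) ∧
    g = fun A B => mhs v B * mhs u A}

/-- Leaving a gap at the letter number `i` of `w`, that is, putting its summation variable at the
pole `0`, splits the chain sum of `w` over `(-A, B)` into a factor over `(0, B)` and a factor over
`(-A, 0)`. This is the coefficient of `X ^ c` in the product of their Taylor series. -/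
noncomputable def gapCoeff (w : List ℕ) (i c A B : ℕ) : ℝ :=
  PowerSeries.coeff c (chainPS (w.take i) 0 B * chainPS (w.drop (i + 1)) (-A) 0)

theorem mul_mem_span_twoSided {v u : List ℕ} (hv : AdmissibleWord v) (hu : ∀ x ∈ u, 1 ≤ x)
    {g h : ℤ → ℤ → ℝ} (hg : g ∈ Submodule.span ℚ (dominating v))
    (hh : h ∈ Submodule.span ℚ (dominating u)) :
    (fun A B : ℕ => g 0 B * h (-A) 0) ∈ Submodule.span ℚ (twoSided (v.length + u.length)) := by
  let right : (ℤ → ℤ → ℝ) →ₗ[ℚ] (ℕ → ℕ → ℝ) :=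
    { toFun g _ B := g 0 B, map_add' _ _ := rfl, map_smul' _ _ := rfl }
  let left : (ℤ → ℤ → ℝ) →ₗ[ℚ] (ℕ → ℕ → ℝ) :=
    { toFun h A _ := h (-A) 0, map_add' _ _ := rfl, map_smul' _ _ := rfl }
  have hle : Submodule.span ℚ (right '' dominating v) * Submodule.span ℚ (left '' dominating u) ≤
      Submodule.span ℚ (twoSided (v.length + u.length)) := by
    rw [Submodule.span_mul_span, Submodule.span_le]
    rintro _ ⟨_, ⟨_, ⟨v', hv', rfl⟩, rfl⟩, _, ⟨_, ⟨u', hu', rfl⟩, rfl⟩, rfl⟩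
    have hmem : (fun A B => mhs v' B * mhs u'.reverse A) ∈ twoSided (v.length + u.length) :=
      ⟨v', u'.reverse, by rw [List.length_reverse, hv'.length_eq, hu'.length_eq],
        hv.of_forall₂_le hv', by simpa using pos_of_forall₂_le hu' hu, rfl⟩
    have hprod : right (chain powInv v') * left (chain powInv u') =
        ((-1) ^ u'.sum : ℚ) • fun A B => mhs v' B * mhs u'.reverse A := by
      ext A B
      simp only [Pi.mul_apply, Pi.smul_apply, left, right, LinearMap.coe_mk, AddHom.coe_mk,
        chain_powInv_neg_zero, mhs, Rat.smul_def]
      push_cast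
      ring
    beta_reduce
    rw [hprod]
    exact Submodule.smul_mem _ _ (Submodule.subset_span hmem)
  exact hle (Submodule.mul_mem_mul (Submodule.apply_mem_span_image_of_mem_span right hg)
    (Submodule.apply_mem_span_image_of_mem_span left hh))

theorem gapCoeff_mem_span {w : List ℕ} (hw : AdmissibleWord w) (i : Fin w.length) (c : ℕ) :
    gapCoeff w i c ∈ Submodule.span ℚ (twoSided (w.length - 1)) := by
  have hcauchy : gapCoeff w i c = ∑ p ∈ antidiagonal c, fun A B : ℕ =>
      PowerSeries.coeff p.1 (chainPS (w.take i) 0 B) *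
        PowerSeries.coeff p.2 (chainPS (w.drop (i + 1)) (-A) 0) := by
    ext A B
    simp only [Finset.sum_apply]
    exact PowerSeries.coeff_mul _ _ _
  have hlen : w.length - 1 = (w.take i).length + (w.drop (i + 1)).length := by
    rw [List.length_take, List.length_drop]
    lia
  rw [hcauchy, hlen]
  exact Submodule.sum_mem _ fun p _ => mul_mem_span_twoSided (hw.take i)
    (fun x hx => hw.1 x (List.mem_of_mem_drop hx)) (coeff_chainPS_mem_span _ _)
    (coeff_chainPS_mem_span _ _)

theorem chain_invLin_eq (w : List ℕ) {a b : ℤ} (h : (0 : ℤ) ∉ Ioo a b) :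
    chain (fun m k => invLin (m : ℝ) ^ k) w a b = ofPowerSeries ℤ ℝ (chainPS w a b) := by
  rw [chainPS, map_chain]
  refine chain_congr (fun m hm => ?_) w
  ext1 k
  rw [map_pow, invLin_eq_ofPowerSeries]
  intro h0
  exact h (Int.cast_eq_zero.1 h0 ▸ hm)

theorem chain_invLin_split (w : List ℕ) {A B : ℕ} (hA : 1 ≤ A) (hB : 1 ≤ B) :
    chain (fun m k => invLin (m : ℝ) ^ k) w (-A) B =
      ofPowerSeries ℤ ℝ (conv (fun v => chainPS v 0 B) (fun u => chainPS u (-A) 0) w) +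
      ∑ i : Fin w.length, invLin 0 ^ w[i] *
        ofPowerSeries ℤ ℝ (chainPS (w.take i) 0 B * chainPS (w.drop (i + 1)) (-A) 0) := by
  rw [chain_split _ w (show -(A : ℤ) < 0 by lia) (show (0 : ℤ) < B by lia)]
  simp only [conv, map_sum, map_mul, Int.cast_zero]
  congr! 2 with i _ i
  · rw [chain_invLin_eq _ (by simp), chain_invLin_eq _ (by simp)]
  · rw [chain_invLin_eq _ (by simp), chain_invLin_eq _ (by simp)]
    ring

theorem residue_chain_invLin_mul (w : List ℕ) {A B : ℕ} (hA : 1 ≤ A) (hB : 1 ≤ B)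
    (q : PowerSeries ℝ) :
    residue (chain (fun m k => invLin (m : ℝ) ^ k) w (-A) B * ofPowerSeries ℤ ℝ q) =
      ∑ i : Fin w.length, ∑ j ∈ range w[i],
        PowerSeries.coeff j q * gapCoeff w i (w[i] - 1 - j) A B := by
  rw [chain_invLin_split w hA hB, add_mul, ← map_mul, map_add, residue_ofPowerSeries, zero_add,
    Finset.sum_mul, map_sum]
  refine Finset.sum_congr rfl fun i _ => ?_
  rw [mul_assoc, ← map_mul]
  cases w[i] with
  | zero => rw [pow_zero, one_mul, residue_ofPowerSeries, Finset.sum_range_zero]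
  | succ k =>
    rw [residue_invLin_zero_pow_mul, mul_comm, PowerSeries.coeff_mul,
      Finset.Nat.sum_antidiagonal_eq_sum_range_succ_mk]
    rfl

theorem residue_chain_invLin_mul_invLin_zero (w : List ℕ) {N : ℕ} (hN : 1 ≤ N) :
    residue (chain (fun m k => invLin (m : ℝ) ^ k) w (-N) N * invLin 0) =
      conv (mhs · N) (fun u => chain powInv u (-N) 0) w +
      ∑ i : Fin w.length, gapCoeff w i w[i] N N := by
  have hreg := residue_invLin_zero_pow_mul 0
    (conv (fun v => chainPS v 0 N) (fun u => chainPS u (-N) 0) w)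
  rw [zero_add, pow_one, mul_comm, PowerSeries.coeff_zero_eq_constantCoeff_apply] at hreg
  rw [chain_invLin_split w hN hN, add_mul, map_add, Finset.sum_mul, map_sum, hreg]
  simp only [conv, map_sum, map_mul, constantCoeff_chainPS, mhs]
  congr! 2 with i
  rw [← map_mul, mul_right_comm, ← pow_succ, residue_invLin_zero_pow_mul, gapCoeff]

theorem sum_residue_chain_Ioo (w : List ℕ) (s : Multiset ℤ) (hs : 2 ≤ w.sum + s.card) (N : ℤ)
    (hN : ∀ p ∈ s, p ∈ Ioo (-N) N) :
    ∑ c ∈ Ioo (-N) N, residue (chain (fun m k => invLin (m : ℝ) ^ k) w (-N - c) (N - c) *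
      (s.map fun p => invLin ((p - c : ℤ) : ℝ)).prod) = 0 := by
  have hcast (m : ℤ) (hm : m ∈ Ioo (-N) N) : (m : ℝ) ∈ (Ioo (-N) N).image ((↑) : ℤ → ℝ) :=
    Finset.mem_image_of_mem _ hm
  have hsum := sum_residue_chain_mul_prod ((Ioo (-N) N).image ((↑) : ℤ → ℝ)) w
    (s.map (↑)) (by simpa using hs) (by simpa using fun p hp => hN p hp) (-N) N hcast
  rw [Finset.sum_image Int.cast_injective.injOn] at hsum
  rw [← hsum]
  refine Finset.sum_congr rfl fun c _ => ?_
  rw [← chain_sub, Multiset.map_map]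
  simp only [Int.cast_sub, Function.comp_def]

theorem sum_gapCoeff_eq_zero {w : List ℕ} (hw : ∀ x ∈ w, 1 ≤ x) (hsum : 2 ≤ w.sum) (N : ℕ) :
    ∑ A ∈ Ico 1 (2 * N), ∑ i : Fin w.length, gapCoeff w i (w[i] - 1) A (2 * N - A) = 0 := by
  rw [← sum_residue_chain_Ioo w 0 (by simpa using hsum) N (by simp)]
  refine Finset.sum_bij' (fun A _ => A - (N : ℤ)) (fun c _ => (N + c).toNat)
    (by simp only [Finset.mem_Ioo, Finset.mem_Ico]; lia)
    (by simp only [Finset.mem_Ioo, Finset.mem_Ico]; lia)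
    (by simp only [Finset.mem_Ico]; lia) (by simp only [Finset.mem_Ioo]; lia) fun A hA => ?_
  have hA := Finset.mem_Ico.1 hA
  rw [Multiset.map_zero, Multiset.prod_zero, ← map_one (ofPowerSeries ℤ ℝ),
    show -(N : ℤ) - (A - N) = -A by ring, show (N : ℤ) - (A - N) = (2 * N - A : ℕ) by lia,
    residue_chain_invLin_mul w hA.1 (by lia)]
  refine Finset.sum_congr rfl fun i _ => ?_
  rw [Finset.sum_eq_single_of_mem 0]
  · simp
  · exact Finset.mem_range.2 (hw _ (List.getElem_mem _))
  · intro j _ hj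
    rw [PowerSeries.coeff_one, if_neg hj, zero_mul]

/-- The sum of `n ^ (-s) * E (N + n) (N - n)` over `0 < |n| < N`. -/
noncomputable def symSum (s : ℕ) (E : ℕ → ℕ → ℝ) (N : ℕ) : ℝ :=
  ∑ n ∈ Ico 1 N, ((n : ℝ) ^ s)⁻¹ * (E (N + n) (N - n) + (-1) ^ s * E (N - n) (N + n))

theorem sum_Ioo_neg_natCast {M : Type*} [AddCommMonoid M] (g : ℤ → M) {N : ℕ} (hN : 1 ≤ N) :
    ∑ m ∈ Ioo (-N : ℤ) N, g m = g 0 + ∑ n ∈ Ico 1 N, (g n + g (-n)) := by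
  have hneg : ∑ m ∈ Ioo (-N : ℤ) 0, g m = ∑ m ∈ Ioo (0 : ℤ) N, g (-m) :=
    Finset.sum_bij' (fun m _ => -m) (fun m _ => -m) (by simp only [Finset.mem_Ioo]; lia)
      (by simp only [Finset.mem_Ioo]; lia) (by simp) (by simp) (by simp)
  have hunion : Ioo (-N : ℤ) N = insert 0 (Ioo (0 : ℤ) N ∪ Ioo (-N : ℤ) 0) := by
    ext; simp only [Finset.mem_Ioo, Finset.mem_union, Finset.mem_insert]; lia
  rw [hunion, Finset.sum_insert (by simp), Finset.sum_union, hneg, Finset.sum_add_distrib,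
    sum_Ioo_zero_natCast, sum_Ioo_zero_natCast]
  exact Finset.disjoint_left.2 fun x => by simp only [Finset.mem_Ioo]; lia

theorem coeff_invLinPS_neg (a : ℝ) (j : ℕ) :
    PowerSeries.coeff j (invLinPS (-a)) = -(a ^ (j + 1))⁻¹ := by
  rw [invLinPS, PowerSeries.coeff_mk, neg_pow a, mul_inv, ← inv_pow, inv_neg_one, ← mul_assoc,
    ← pow_add, Odd.neg_one_pow ⟨j, by ring⟩, neg_one_mul]

theorem residue_chain_invLin_mul_invLin_neg (w : List ℕ) {A B : ℕ} (hA : 1 ≤ A) (hB : 1 ≤ B)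
    {c : ℝ} (hc : c ≠ 0) :
    residue (chain (fun m k => invLin (m : ℝ) ^ k) w (-A) B * invLin (-c)) =
      -∑ i : Fin w.length, ∑ j ∈ range w[i], (c ^ (j + 1))⁻¹ * gapCoeff w i (w[i] - 1 - j) A B := by
  rw [invLin_eq_ofPowerSeries (neg_ne_zero.2 hc), residue_chain_invLin_mul w hA hB]
  simp only [coeff_invLinPS_neg, neg_mul, Finset.sum_neg_distrib]

theorem residue_chain_invLin_add_residue (w : List ℕ) {N n : ℕ} (hn : n ∈ Ico 1 N) :
    residue (chain (fun m k => invLin (m : ℝ) ^ k) w (-N - n) (N - n) *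
        invLin ((0 - n : ℤ) : ℝ)) +
      residue (chain (fun m k => invLin (m : ℝ) ^ k) w (-N - -n) (N - -n) *
        invLin ((0 - -n : ℤ) : ℝ)) =
      -∑ i : Fin w.length, ∑ j ∈ range w[i], ((n : ℝ) ^ (j + 1))⁻¹ *
        (gapCoeff w i (w[i] - 1 - j) (N + n) (N - n) +
          (-1) ^ (j + 1) * gapCoeff w i (w[i] - 1 - j) (N - n) (N + n)) := by
  obtain ⟨hn1, hnN⟩ := Finset.mem_Ico.1 hn
  have hn0 : (n : ℝ) ≠ 0 := by exact_mod_cast (show n ≠ 0 by lia)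
  rw [show -(N : ℤ) - n = -(N + n : ℕ) by lia, show (N : ℤ) - n = (N - n : ℕ) by lia,
    show -(N : ℤ) - -n = -(N - n : ℕ) by lia, show (N : ℤ) - -n = (N + n : ℕ) by lia,
    zero_sub, zero_sub, Int.cast_neg, Int.cast_neg, Int.cast_neg, Int.cast_natCast,
    residue_chain_invLin_mul_invLin_neg w (by lia) (by lia) hn0,
    residue_chain_invLin_mul_invLin_neg w (by lia) (by lia) (neg_ne_zero.2 hn0), ← neg_add]
  simp only [← Finset.sum_add_distrib]
  refine congrArg _ (Finset.sum_congr rfl fun i _ => Finset.sum_congr rfl fun j _ => ?_)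
  rw [neg_pow (n : ℝ), mul_inv, ← inv_pow (-1 : ℝ), inv_neg_one]
  ring

theorem conv_chain_add_sum_gapCoeff {w : List ℕ} (hsum : 1 ≤ w.sum) {N : ℕ} (hN : 1 ≤ N) :
    conv (mhs · N) (fun u => chain powInv u (-N) 0) w + ∑ i : Fin w.length, gapCoeff w i w[i] N N =
      ∑ i : Fin w.length, ∑ j ∈ range w[i], symSum (j + 1) (gapCoeff w i (w[i] - 1 - j)) N := by
  have hres := sum_residue_chain_Ioo w {0} (by simpa using hsum) N
    (by simpa using Nat.pos_of_ne_zero (by lia))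
  simp only [Multiset.map_singleton, Multiset.prod_singleton] at hres
  rw [sum_Ioo_neg_natCast _ hN,
    Finset.sum_congr rfl fun n hn => residue_chain_invLin_add_residue w hn,
    Finset.sum_neg_distrib, ← sub_eq_add_neg, sub_eq_zero, sub_zero, sub_zero, sub_zero,
    Int.cast_zero, residue_chain_invLin_mul_invLin_zero w hN] at hres
  rw [hres, Finset.sum_comm]
  exact Finset.sum_congr rfl fun i _ => Finset.sum_comm

end GapCoefficients

section Growth

variable {ι κ : Type*} {size : ι → ℕ} {ω : ι → ℝ}

/-- One plus the harmonic number `∑_{0 < m < N} 1 / m`: the logarithmic scale on which the growth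
of truncated sums is measured. -/
noncomputable def logScale (N : ℕ) : ℝ := 1 + mhs [1] N

theorem mhs_one (N : ℕ) : mhs [1] N = ∑ m ∈ Ico 1 N, (m : ℝ)⁻¹ := by
  simp [mhs_cons, mhs_nil]

theorem mhs_nonneg (w : List ℕ) (N : ℕ) : 0 ≤ mhs w N := by
  induction w generalizing N with
  | nil => simp [mhs_nil]
  | cons k w ih =>
    rw [mhs_cons]
    exact Finset.sum_nonneg fun m _ => mul_nonneg (by positivity) (ih m)

theorem mhs_mono (w : List ℕ) : Monotone (mhs w) := by
  intro M N h
  cases w with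
  | nil => simp [mhs_nil]
  | cons k w =>
    rw [mhs_cons, mhs_cons]
    exact Finset.sum_le_sum_of_subset_of_nonneg (Finset.Ico_subset_Ico_right h) fun m _ _ =>
      mul_nonneg (by positivity) (mhs_nonneg w m)

theorem one_le_logScale (N : ℕ) : 1 ≤ logScale N := le_add_of_nonneg_right (mhs_nonneg [1] N)

theorem logScale_nonneg (N : ℕ) : 0 ≤ logScale N := zero_le_one.trans (one_le_logScale N)

theorem logScale_mono : Monotone logScale := (mhs_mono [1]).const_add 1

theorem logScale_two_mul_le (N : ℕ) : logScale (2 * N) ≤ 2 * logScale N := by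
  rcases Nat.eq_zero_or_pos N with rfl | hN
  · linarith [logScale_nonneg 0]
  have hsum : ∑ m ∈ Ico N (2 * N), (m : ℝ)⁻¹ ≤ 1 :=
    calc ∑ m ∈ Ico N (2 * N), (m : ℝ)⁻¹ ≤ ∑ _m ∈ Ico N (2 * N), (N : ℝ)⁻¹ := by
          gcongr with m hm
          exact (Finset.mem_Ico.1 hm).1
      _ = 1 := by
          rw [Finset.sum_const, Nat.card_Ico, nsmul_eq_mul, show 2 * N - N = N by lia,
            mul_inv_cancel₀ (by positivity)]
  have hsplit := Finset.sum_Ico_consecutive (fun m : ℕ => (m : ℝ)⁻¹) hN (show N ≤ 2 * N by lia)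
  rw [← mhs_one, ← mhs_one] at hsplit
  unfold logScale
  linarith [mhs_nonneg [1] N]

theorem inv_pow_le_inv {k : ℕ} (hk : 1 ≤ k) (m : ℕ) : ((m : ℝ) ^ k)⁻¹ ≤ (m : ℝ)⁻¹ := by
  rcases Nat.eq_zero_or_pos m with rfl | hm
  · simp [show k ≠ 0 by lia]
  · exact inv_anti₀ (by positivity) (le_self_pow₀ (by exact_mod_cast hm) (by lia))

theorem mhs_cons_eq_sum_range {k : ℕ} (hk : 1 ≤ k) (w : List ℕ) (N : ℕ) :
    mhs (k :: w) N = ∑ m ∈ range N, ((m : ℝ) ^ k)⁻¹ * mhs w m := by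
  rw [mhs_cons]
  refine Finset.sum_subset (fun m hm => ?_) fun m hm hm' => ?_
  · exact Finset.mem_range.2 (Finset.mem_Ico.1 hm).2
  · obtain rfl : m = 0 := by simp only [Finset.mem_range, Finset.mem_Ico] at hm hm'; lia
    simp [show k ≠ 0 by lia]

theorem mhs_cons_sub_le {k : ℕ} (hk : 1 ≤ k) (w : List ℕ) {M N : ℕ} (hMN : M ≤ N) :
    mhs (k :: w) N - mhs (k :: w) M ≤ (∑ m ∈ Ico M N, (m : ℝ)⁻¹) * mhs w N := by
  rw [mhs_cons_eq_sum_range hk, mhs_cons_eq_sum_range hk, ← Finset.sum_Ico_eq_sub _ hMN,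
    Finset.sum_mul]
  exact Finset.sum_le_sum fun m hm => mul_le_mul (inv_pow_le_inv hk m)
    (mhs_mono w (Finset.mem_Ico.1 hm).2.le) (mhs_nonneg w m) (by positivity)

theorem sum_inv_le_logScale (M N : ℕ) : 1 + ∑ m ∈ Ico M N, (m : ℝ)⁻¹ ≤ logScale N := by
  rw [logScale, mhs_cons_eq_sum_range le_rfl, Finset.range_eq_Ico]
  simp only [pow_one, mhs_nil, mul_one]
  gcongr
  exact Nat.zero_le M

theorem mhs_le_logScale_pow {w : List ℕ} (hw : ∀ x ∈ w, 1 ≤ x) (N : ℕ) :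
    mhs w N ≤ logScale N ^ w.length := by
  induction w with
  | nil => simp [mhs_nil]
  | cons k w ih =>
    rw [List.forall_mem_cons] at hw
    calc mhs (k :: w) N = mhs (k :: w) N - mhs (k :: w) 0 := by simp [mhs_cons k w 0]
      _ ≤ (∑ m ∈ Ico 0 N, (m : ℝ)⁻¹) * mhs w N := mhs_cons_sub_le hw.1 w (Nat.zero_le N)
      _ ≤ logScale N * logScale N ^ w.length :=
          mul_le_mul (by linarith [sum_inv_le_logScale 0 N]) (ih hw.2) (mhs_nonneg w N)
            (logScale_nonneg N)
      _ = logScale N ^ (k :: w).length := by rw [List.length_cons, pow_succ']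

theorem mul_sum_inv_le {M N : ℕ} (hMN : M ≤ N) :
    (N : ℝ) * ∑ m ∈ Ico M N, (m : ℝ)⁻¹ ≤ (N - M) * logScale N := by
  calc (N : ℝ) * ∑ m ∈ Ico M N, (m : ℝ)⁻¹
      ≤ ∑ m ∈ Ico M N, (1 + (N - M) * (m : ℝ)⁻¹) := by
        rw [Finset.mul_sum]
        refine Finset.sum_le_sum fun m hm => ?_
        have hmM : (M : ℝ) ≤ m := by exact_mod_cast (Finset.mem_Ico.1 hm).1
        have hMm : (M : ℝ) * (m : ℝ)⁻¹ ≤ 1 := by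
          rw [← div_eq_mul_inv]
          exact div_le_one_of_le₀ hmM (Nat.cast_nonneg m)
        linarith
    _ = (N - M) * (1 + ∑ m ∈ Ico M N, (m : ℝ)⁻¹) := by
        rw [Finset.sum_add_distrib, ← Finset.mul_sum, Finset.sum_const, Nat.card_Ico,
          nsmul_eq_mul, mul_one, Nat.cast_sub hMN]
        ring
    _ ≤ (N - M) * logScale N :=
        mul_le_mul_of_nonneg_left (sum_inv_le_logScale M N)
          (sub_nonneg.2 (by exact_mod_cast hMN))

theorem mul_mhs_sub_le {w : List ℕ} (hw : ∀ x ∈ w, 1 ≤ x) {M N : ℕ} (hMN : M ≤ N) :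
    (N : ℝ) * (mhs w N - mhs w M) ≤ (N - M) * logScale N ^ w.length := by
  have hMN' : (0 : ℝ) ≤ N - M := sub_nonneg.2 (by exact_mod_cast hMN)
  cases w with
  | nil => simpa [mhs_nil] using hMN
  | cons k w =>
    rw [List.forall_mem_cons] at hw
    calc (N : ℝ) * (mhs (k :: w) N - mhs (k :: w) M)
        ≤ N * ((∑ m ∈ Ico M N, (m : ℝ)⁻¹) * mhs w N) := by
          gcongr
          exact mhs_cons_sub_le hw.1 w hMN
      _ = N * (∑ m ∈ Ico M N, (m : ℝ)⁻¹) * mhs w N := by ring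
      _ ≤ (N - M) * logScale N * logScale N ^ w.length :=
          mul_le_mul (mul_sum_inv_le hMN) (mhs_le_logScale_pow hw.2 N) (mhs_nonneg w N)
            (mul_nonneg hMN' (logScale_nonneg N))
      _ = (N - M) * logScale N ^ (k :: w).length := by rw [List.length_cons]; ring

theorem logScale_le_two_add_log (N : ℕ) : logScale N ≤ 2 + Real.log N := by
  have hharm : mhs [1] N = (harmonic (N - 1) : ℝ) := by
    rw [mhs_one, Finset.sum_Ico_eq_sum_range, harmonic]
    push_cast
    exact Finset.sum_congr rfl fun _ _ => by rw [add_comm]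
  have hlog : Real.log ((N - 1 : ℕ) : ℝ) ≤ Real.log N := by
    rcases Nat.eq_zero_or_pos (N - 1) with h | h
    · rw [h, Nat.cast_zero, Real.log_zero]
      exact Real.log_natCast_nonneg N
    · exact Real.log_le_log (by exact_mod_cast h) (by exact_mod_cast Nat.sub_le N 1)
  have hle := harmonic_le_one_add_log (N - 1)
  rw [logScale, hharm]
  linarith

theorem exists_logScale_pow_le {δ : ℝ} (hδ : 0 < δ) (p : ℕ) :
    ∃ C : ℝ, 0 ≤ C ∧ ∀ N : ℕ, 1 ≤ N → logScale N ^ p ≤ C * (N : ℝ) ^ δ := by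
  set ε : ℝ := δ / (p + 1) with hε
  have hε0 : 0 < ε := by positivity
  refine ⟨(2 + 1 / ε) ^ (p + 1), by positivity, fun N hN => ?_⟩
  have hN' : (1 : ℝ) ≤ N := by exact_mod_cast hN
  have hscale : logScale N ≤ (2 + 1 / ε) * (N : ℝ) ^ ε := by
    have hlog := Real.log_le_rpow_div (Nat.cast_nonneg N) hε0
    have hone := Real.one_le_rpow hN' hε0.le
    rw [add_mul, one_div_mul_eq_div]
    linarith [logScale_le_two_add_log N]
  calc logScale N ^ p ≤ logScale N ^ (p + 1) :=
        pow_le_pow_right₀ (one_le_logScale N) (Nat.le_succ p)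
    _ ≤ ((2 + 1 / ε) * (N : ℝ) ^ ε) ^ (p + 1) := pow_le_pow_left₀ (logScale_nonneg N) hscale _
    _ = (2 + 1 / ε) ^ (p + 1) * (N : ℝ) ^ δ := by
        rw [mul_pow, ← Real.rpow_natCast ((N : ℝ) ^ ε), ← Real.rpow_mul (by positivity), hε]
        congr 2
        push_cast
        field_simp

/-- The algebra of functions that are bounded by a power of `logScale` of the size of their
argument. -/
noncomputable def logBounded (size : ι → ℕ) : Subalgebra ℝ (ι → ℝ) where
  carrier := {f | ∃ (C : ℝ) (p : ℕ), 0 ≤ C ∧ ∀ i, |f i| ≤ C * logScale (size i) ^ p}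
  mul_mem' := by
    rintro f g ⟨C, p, hC, hf⟩ ⟨D, q, hD, hg⟩
    refine ⟨C * D, p + q, by positivity, fun i => ?_⟩
    rw [Pi.mul_apply, abs_mul, pow_add, mul_mul_mul_comm]
    exact mul_le_mul (hf i) (hg i) (abs_nonneg _) ((abs_nonneg _).trans (hf i))
  add_mem' := by
    rintro f g ⟨C, p, hC, hf⟩ ⟨D, q, hD, hg⟩
    refine ⟨C + D, p + q, by positivity, fun i => ?_⟩
    have hp := pow_le_pow_right₀ (one_le_logScale (size i)) (Nat.le_add_right p q)
    have hq := pow_le_pow_right₀ (one_le_logScale (size i)) (Nat.le_add_left q p)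
    calc |(f + g) i| ≤ |f i| + |g i| := abs_add_le _ _
      _ ≤ C * logScale (size i) ^ p + D * logScale (size i) ^ q := add_le_add (hf i) (hg i)
      _ ≤ C * logScale (size i) ^ (p + q) + D * logScale (size i) ^ (p + q) := by gcongr
      _ = (C + D) * logScale (size i) ^ (p + q) := by ring
  algebraMap_mem' r := ⟨|r|, 0, abs_nonneg r, fun i => by simp⟩

theorem mem_logBounded {f : ι → ℝ} : f ∈ logBounded size ↔
    ∃ (C : ℝ) (p : ℕ), 0 ≤ C ∧ ∀ i, |f i| ≤ C * logScale (size i) ^ p := Iff.rfl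

theorem mem_logBounded_of_abs_le {f g : ι → ℝ} (hg : g ∈ logBounded size)
    (h : ∀ i, |f i| ≤ |g i|) : f ∈ logBounded size := by
  obtain ⟨C, p, hC, hg⟩ := hg
  exact ⟨C, p, hC, fun i => (h i).trans (hg i)⟩

theorem comp_mem_logBounded {f : ι → ℝ} (hf : f ∈ logBounded size) {φ : κ → ι} {size' : κ → ℕ}
    (hφ : ∀ k, size (φ k) ≤ size' k) : f ∘ φ ∈ logBounded size' := by
  obtain ⟨C, p, hC, hf⟩ := hf
  refine ⟨C, p, hC, fun k => (hf (φ k)).trans ?_⟩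
  gcongr
  exacts [logScale_nonneg _, logScale_mono (hφ k)]

theorem mhs_mem_logBounded {w : List ℕ} (hw : ∀ x ∈ w, 1 ≤ x) : mhs w ∈ logBounded id :=
  ⟨1, w.length, zero_le_one, fun N => by
    rw [abs_of_nonneg (mhs_nonneg w N), one_mul]
    exact mhs_le_logScale_pow hw N⟩

/-- The functions that are `O(1 / ω)`, up to powers of the logarithm of the size of the argument;
nothing is required where `ω` vanishes. -/
noncomputable def logDominated (size : ι → ℕ) (ω : ι → ℝ) : Submodule ℝ (ι → ℝ) :=
  (Subalgebra.toSubmodule (logBounded size)).comap (LinearMap.mulLeft ℝ ω)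

theorem mem_logDominated {f : ι → ℝ} : f ∈ logDominated size ω ↔ ω * f ∈ logBounded size := Iff.rfl

theorem mul_mem_logDominated {f g : ι → ℝ} (hf : f ∈ logDominated size ω)
    (hg : g ∈ logBounded size) : f * g ∈ logDominated size ω := by
  rw [mem_logDominated, ← mul_assoc]
  exact (logBounded size).mul_mem hf hg

theorem comp_mem_logDominated {f : ι → ℝ} (hf : f ∈ logDominated size ω) {φ : κ → ι}
    {size' : κ → ℕ} {ω' : κ → ℝ} (hφ : ∀ k, size (φ k) ≤ size' k)
    (hω : ∀ k, |ω' k| ≤ |ω (φ k)|) : f ∘ φ ∈ logDominated size' ω' := by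
  refine mem_logBounded_of_abs_le (comp_mem_logBounded hf hφ) fun k => ?_
  simp only [LinearMap.mulLeft_apply, Pi.mul_apply, Function.comp_apply, abs_mul]
  exact mul_le_mul_of_nonneg_right (hω k) (abs_nonneg _)

/-- The sequences that are `O(N ^ (-1/2) (log N) ^ p)` for some `p`. -/
noncomputable abbrev errors : Submodule ℝ (ℕ → ℝ) := logDominated id fun N => √(N : ℝ)

theorem mem_errors {e : ℕ → ℝ} : e ∈ errors ↔
    ∃ (C : ℝ) (p : ℕ), 0 ≤ C ∧ ∀ N : ℕ, 1 ≤ N → √(N : ℝ) * |e N| ≤ C * logScale N ^ p := by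
  have habs (N : ℕ) : |((fun N : ℕ => √(N : ℝ)) * e) N| = √(N : ℝ) * |e N| := by
    rw [Pi.mul_apply, abs_mul, abs_of_nonneg (Real.sqrt_nonneg _)]
  simp only [mem_logDominated, mem_logBounded, habs, id]
  refine ⟨fun ⟨C, p, hC, h⟩ => ⟨C, p, hC, fun N _ => h N⟩,
    fun ⟨C, p, hC, h⟩ => ⟨C, p, hC, fun N => ?_⟩⟩
  rcases Nat.eq_zero_or_pos N with rfl | hN
  · simpa using mul_nonneg hC (pow_nonneg (logScale_nonneg 0) p)
  · exact h N hN

theorem one_le_sqrt_natCast {N : ℕ} (hN : 1 ≤ N) : 1 ≤ √(N : ℝ) :=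
  Real.one_le_sqrt.2 (by exact_mod_cast hN)

theorem mem_logBounded_of_mem_errors {e : ℕ → ℝ} (he : e ∈ errors) : e ∈ logBounded id := by
  obtain ⟨C, p, hC, h⟩ := mem_errors.1 he
  refine ⟨C + |e 0|, p, by positivity, fun N => ?_⟩
  have hpow : 1 ≤ logScale N ^ p := one_le_pow₀ (one_le_logScale N)
  rw [id, add_mul]
  rcases Nat.eq_zero_or_pos N with rfl | hN
  · exact (le_mul_of_one_le_right (abs_nonneg _) hpow).trans
      (le_add_of_nonneg_left (by positivity))
  · calc |e N| ≤ √(N : ℝ) * |e N| :=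
          le_mul_of_one_le_left (abs_nonneg _) (one_le_sqrt_natCast hN)
      _ ≤ C * logScale N ^ p := h N hN
      _ ≤ C * logScale N ^ p + |e 0| * logScale N ^ p := le_add_of_nonneg_right (by positivity)

theorem tendsto_logScale_pow_div_sqrt (C : ℝ) (p : ℕ) :
    Tendsto (fun N : ℕ => C * logScale N ^ p / √(N : ℝ)) atTop (𝓝 0) := by
  obtain ⟨D, -, h⟩ := exists_logScale_pow_le (δ := 1 / 4) (by norm_num) p
  have hlim : Tendsto (fun N : ℕ => D * (N : ℝ) ^ (-(1 / 4) : ℝ)) atTop (𝓝 0) := by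
    simpa using ((tendsto_rpow_neg_atTop (show (0 : ℝ) < 1 / 4 by norm_num)).comp
      tendsto_natCast_atTop_atTop).const_mul D
  have hone : Tendsto (fun N : ℕ => logScale N ^ p / √(N : ℝ)) atTop (𝓝 0) := by
    refine squeeze_zero' (Eventually.of_forall fun N => ?_) ?_ hlim
    · exact div_nonneg (pow_nonneg (logScale_nonneg N) p) (Real.sqrt_nonneg _)
    · filter_upwards [eventually_ge_atTop 1] with N hN
      have hN' : (0 : ℝ) < N := by exact_mod_cast hN
      rw [div_le_iff₀ (Real.sqrt_pos.2 hN'), Real.sqrt_eq_rpow, mul_assoc, ← Real.rpow_add hN']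
      norm_num
      simpa using h N hN
  simpa [mul_div_assoc] using hone.const_mul C

theorem tendsto_zero_of_mem_errors {e : ℕ → ℝ} (he : e ∈ errors) : Tendsto e atTop (𝓝 0) := by
  obtain ⟨C, p, -, h⟩ := mem_errors.1 he
  refine squeeze_zero_norm' ?_ (tendsto_logScale_pow_div_sqrt C p)
  filter_upwards [eventually_ge_atTop 1] with N hN
  rw [Real.norm_eq_abs, le_div_iff₀ (zero_lt_one.trans_le (one_le_sqrt_natCast hN)), mul_comm]
  exact h N hN

theorem tendsto_mhs_one_atTop : Tendsto (mhs [1]) atTop atTop := by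
  rw [← tendsto_add_atTop_iff_nat 1]
  refine Real.tendsto_sum_range_one_div_nat_succ_atTop.congr fun n => ?_
  rw [mhs_one, Finset.sum_Ico_eq_sum_range]
  simp [add_comm]

theorem inv_sqrt_le {N : ℕ} (hN : 1 ≤ N) :
    (√(N : ℝ))⁻¹ ≤ 3 * (√((N + 1 : ℕ) : ℝ) - √(N : ℝ)) := by
  have hs := Real.sq_sqrt (Nat.cast_nonneg (α := ℝ) N)
  have ht := Real.sq_sqrt (Nat.cast_nonneg (α := ℝ) (N + 1))
  have hs1 := one_le_sqrt_natCast hN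
  have hst : √(N : ℝ) ≤ √((N + 1 : ℕ) : ℝ) := Real.sqrt_le_sqrt (by simp)
  push_cast at ht hst ⊢
  rw [inv_le_iff_one_le_mul₀ (by positivity)]
  nlinarith

theorem sqrt_succ_le_two_mul_sqrt {N : ℕ} (hN : 1 ≤ N) :
    √((N + 1 : ℕ) : ℝ) ≤ 2 * √(N : ℝ) := by
  rw [Real.sqrt_le_left (by positivity), mul_pow, Real.sq_sqrt (Nat.cast_nonneg N)]
  exact_mod_cast (by lia : N + 1 ≤ 2 ^ 2 * N)

theorem inv_sqrt_pow_three_le {N : ℕ} (hN : 1 ≤ N) :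
    (√(N : ℝ) ^ 3)⁻¹ ≤ 6 * ((√(N : ℝ))⁻¹ - (√((N + 1 : ℕ) : ℝ))⁻¹) := by
  have hle := inv_sqrt_le hN
  have htwo := sqrt_succ_le_two_mul_sqrt hN
  have hs : 0 < √(N : ℝ) := zero_lt_one.trans_le (one_le_sqrt_natCast hN)
  have ht : 0 < √((N + 1 : ℕ) : ℝ) := zero_lt_one.trans_le (one_le_sqrt_natCast (by lia))
  generalize √(N : ℝ) = s at *
  generalize √((N + 1 : ℕ) : ℝ) = t at *
  calc (s ^ 3)⁻¹ = 2 * s⁻¹ * (s * (2 * s))⁻¹ := by field_simp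
    _ ≤ 2 * (3 * (t - s)) * (s * t)⁻¹ := by
        gcongr
        linarith [inv_pos.2 hs]
    _ = 6 * (s⁻¹ - t⁻¹) := by field_simp; ring

theorem exists_mhs_succ_sub_le {k : ℕ} {w : List ℕ} (hw : AdmissibleWord (k :: w)) :
    ∃ C : ℝ, 0 ≤ C ∧ ∀ N : ℕ, 1 ≤ N → mhs (k :: w) (N + 1) - mhs (k :: w) N ≤
      C * ((√(N : ℝ))⁻¹ - (√((N + 1 : ℕ) : ℝ))⁻¹) := by
  obtain ⟨hk, hw⟩ := admissibleWord_cons.1 hw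
  obtain ⟨D, hD, hscale⟩ := exists_logScale_pow_le (δ := 1 / 2) (by norm_num) w.length
  refine ⟨6 * D, by positivity, fun N hN => ?_⟩
  have hs : √(N : ℝ) ≠ 0 := (zero_lt_one.trans_le (one_le_sqrt_natCast hN)).ne'
  have hmhs : mhs w N ≤ D * √(N : ℝ) := by
    rw [Real.sqrt_eq_rpow]
    exact (mhs_le_logScale_pow hw N).trans (hscale N hN)
  have hpow : ((N : ℝ) ^ k)⁻¹ ≤ (√(N : ℝ) ^ 4)⁻¹ := by
    rw [show √(N : ℝ) ^ 4 = (√(N : ℝ) ^ 2) ^ 2 by ring, Real.sq_sqrt (Nat.cast_nonneg N)]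
    exact inv_anti₀ (by positivity) (pow_le_pow_right₀ (by exact_mod_cast hN) hk)
  rw [mhs_cons_succ _ _ hN, add_sub_cancel_left]
  calc ((N : ℝ) ^ k)⁻¹ * mhs w N ≤ (√(N : ℝ) ^ 4)⁻¹ * (D * √(N : ℝ)) :=
        mul_le_mul hpow hmhs (mhs_nonneg w N) (by positivity)
    _ = D * (√(N : ℝ) ^ 3)⁻¹ := by field_simp [hs]
    _ ≤ D * (6 * ((√(N : ℝ))⁻¹ - (√((N + 1 : ℕ) : ℝ))⁻¹)) := by
        gcongr
        exact inv_sqrt_pow_three_le hN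
    _ = 6 * D * ((√(N : ℝ))⁻¹ - (√((N + 1 : ℕ) : ℝ))⁻¹) := by ring

theorem mhs_sub_mem_errors {w : List ℕ} (hw : AdmissibleWord w) {z : ℝ}
    (hz : Tendsto (mhs w) atTop (𝓝 z)) : (fun N => mhs w N - z) ∈ errors := by
  rcases w with _ | ⟨k, w⟩
  · have hz1 : z = 1 := tendsto_nhds_unique hz tendsto_const_nhds
    simp only [hz1, mhs_nil, sub_self]
    exact errors.zero_mem
  obtain ⟨C, hC, hstep⟩ := exists_mhs_succ_sub_le hw
  have htelescope {N : ℕ} (hN : 1 ≤ N) {K : ℕ} (hK : N ≤ K) :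
      mhs (k :: w) K - mhs (k :: w) N ≤ C * ((√(N : ℝ))⁻¹ - (√(K : ℝ))⁻¹) := by
    induction K, hK using Nat.le_induction with
    | base => simp
    | succ K hK ih => linarith [hstep K (hN.trans hK)]
  refine mem_errors.2 ⟨C, 0, hC, fun N hN => ?_⟩
  have hlower : mhs (k :: w) N ≤ z :=
    ge_of_tendsto hz ((eventually_ge_atTop N).mono fun K hK => mhs_mono _ hK)
  have hupper : z ≤ mhs (k :: w) N + C * (√(N : ℝ))⁻¹ := by
    refine le_of_tendsto hz ((eventually_ge_atTop N).mono fun K hK => ?_)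
    have hnonneg : 0 ≤ C * (√(K : ℝ))⁻¹ := by positivity
    linarith [htelescope hN hK]
  have hs : 0 < √(N : ℝ) := zero_lt_one.trans_le (one_le_sqrt_natCast hN)
  rw [abs_sub_comm, abs_of_nonneg (sub_nonneg.2 hlower), pow_zero, mul_one, mul_comm,
    ← le_div_iff₀ hs, div_eq_mul_inv]
  linarith

end Growth

section Values

open Classical in
/-- The strictly increasing `d`-tuples with entries in `[1, N)`. -/
noncomputable def increasingTuples (d N : ℕ) : Finset (Fin d → ℕ) :=
  {m ∈ Fintype.piFinset fun _ => Ico 1 N | StrictMono m}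

theorem mem_increasingTuples {d N : ℕ} {m : Fin d → ℕ} :
    m ∈ increasingTuples d N ↔ (∀ i, m i ∈ Ico 1 N) ∧ StrictMono m := by
  rw [increasingTuples, Finset.mem_filter, Fintype.mem_piFinset]

theorem increasingTuples_zero (N : ℕ) : increasingTuples 0 N = {Fin.elim0} := by
  ext m
  simp [mem_increasingTuples, Subsingleton.elim m Fin.elim0, Subsingleton.strictMono]

theorem strictMono_snoc_iff {d : ℕ} {m : Fin d → ℕ} {n : ℕ} :
    StrictMono (Fin.snoc m n : Fin (d + 1) → ℕ) ↔ StrictMono m ∧ ∀ i, m i < n := by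
  refine ⟨fun h => ⟨fun i j hij => ?_, fun i => ?_⟩, ?_⟩
  · simpa using h (Fin.castSucc_lt_castSucc_iff.2 hij)
  · simpa using h (Fin.castSucc_lt_last i)
  · rintro ⟨hm, hn⟩ i j hij
    induction j using Fin.lastCases with
    | last =>
      obtain ⟨i, rfl⟩ := Fin.exists_castSucc_eq.2 hij.ne
      simpa using hn i
    | cast j =>
      obtain ⟨i, rfl⟩ := Fin.exists_castSucc_eq.2 (hij.trans (Fin.castSucc_lt_last j)).ne
      simpa using hm (Fin.castSucc_lt_castSucc_iff.1 hij)

theorem snoc_mem_increasingTuples {d N n : ℕ} {m : Fin d → ℕ} :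
    (Fin.snoc m n : Fin (d + 1) → ℕ) ∈ increasingTuples (d + 1) N ↔
      n ∈ Ico 1 N ∧ m ∈ increasingTuples d n := by
  simp only [mem_increasingTuples, Fin.forall_fin_succ', Fin.snoc_castSucc, Fin.snoc_last,
    strictMono_snoc_iff, Finset.mem_Ico]
  grind

theorem sum_increasingTuples_succ {d : ℕ} (N : ℕ) (f : (Fin (d + 1) → ℕ) → ℝ) :
    ∑ m ∈ increasingTuples (d + 1) N, f m =
      ∑ n ∈ Ico 1 N, ∑ m ∈ increasingTuples d n, f (Fin.snoc m n : Fin (d + 1) → ℕ) := by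
  rw [Finset.sum_sigma']
  refine Finset.sum_bij' (fun m _ => ⟨m (Fin.last d), Fin.init m⟩)
    (fun x _ => (Fin.snoc x.2 x.1 : Fin (d + 1) → ℕ)) ?_ ?_ ?_ ?_ ?_
  · intro m hm
    rw [← Fin.snoc_init_self m] at hm
    exact Finset.mem_sigma.2 (snoc_mem_increasingTuples.1 hm)
  · exact fun x hx => snoc_mem_increasingTuples.2 (Finset.mem_sigma.1 hx)
  · exact fun m _ => Fin.snoc_init_self m
  · rintro ⟨n, m⟩ _
    simp
  · exact fun m _ => by rw [Fin.snoc_init_self]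

theorem mhs_reverse_ofFn {d : ℕ} (k : Fin d → ℕ) (N : ℕ) :
    mhs (List.ofFn k).reverse N = ∑ m ∈ increasingTuples d N, ∏ i, ((m i : ℝ) ^ k i)⁻¹ := by
  induction d generalizing N with
  | zero => simp [mhs_nil, increasingTuples_zero]
  | succ d ih =>
    rw [List.ofFn_succ', List.concat_eq_append, List.reverse_append, List.reverse_singleton,
      List.singleton_append, mhs_cons, sum_increasingTuples_succ]
    simp only [ih, Finset.mul_sum, Fin.prod_univ_castSucc, Fin.snoc_castSucc, Fin.snoc_last,
      mul_comm]

theorem tendsto_mhs_zeta {d : ℕ} {k : Fin d → ℕ} (hk : Admissible k) :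
    Tendsto (mhs (List.ofFn k).reverse) atTop (𝓝 (zeta k)) := by
  classical
  let tuplesBelow (N : ℕ) : Finset (Tuples d) := (increasingTuples d N).subtype _
  have hmem {N : ℕ} {m : Tuples d} : m ∈ tuplesBelow N ↔ ∀ i, m.1 i < N := by
    simp only [tuplesBelow, Finset.mem_subtype, mem_increasingTuples, Finset.mem_Ico]
    exact ⟨fun h i => (h.1 i).2, fun h => ⟨fun i => ⟨m.2.1 i, h i⟩, m.2.2⟩⟩
  have htop : Tendsto tuplesBelow atTop atTop := by
    refine tendsto_atTop_finset_of_monotone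
      (fun M N hMN m hm => hmem.2 fun i => (hmem.1 hm i).trans_le hMN) fun m => ?_
    exact ⟨∑ i, m.1 i + 1, hmem.2 fun i => Nat.lt_succ_of_le
      (Finset.single_le_sum (fun j _ => Nat.zero_le (m.1 j)) (Finset.mem_univ i))⟩
  refine ((summable_term k hk).hasSum.comp htop).congr fun N => ?_
  have hall (m : Fin d → ℕ) (hm : m ∈ increasingTuples d N) :
      (∀ i, 0 < m i) ∧ StrictMono m := by
    rw [mem_increasingTuples] at hm
    exact ⟨fun i => (Finset.mem_Ico.1 (hm.1 i)).1, hm.2⟩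
  rw [mhs_reverse_ofFn, ← Finset.sum_subtype_of_mem _ hall]
  simp only [Function.comp_apply, tuplesBelow, term, one_div, Finset.prod_inv_distrib]

theorem admissibleWord_reverse_ofFn {d : ℕ} {k : Fin d → ℕ} (hk : Admissible k) :
    AdmissibleWord (List.ofFn k).reverse := by
  cases d with
  | zero => simpa using admissibleWord_nil
  | succ d =>
    rw [List.ofFn_succ', List.concat_eq_append, List.reverse_append, List.reverse_singleton,
      List.singleton_append, admissibleWord_cons]
    refine ⟨hk.2 (Fin.last d) (by simp), fun x hx => ?_⟩
    rw [List.mem_reverse, List.mem_ofFn] at hx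
    obtain ⟨i, rfl⟩ := hx
    exact hk.1 _

/-- The multiple zeta value of a word; a word lists the exponents from last to first. -/
noncomputable def zetaWord (w : List ℕ) : ℝ := zeta fun i : Fin w.length => w.get i.rev

theorem admissible_get_rev {w : List ℕ} (hw : AdmissibleWord w) :
    Admissible fun i : Fin w.length => w.get i.rev := by
  refine ⟨fun i => hw.1 _ (List.get_mem _ _), fun i hi => ?_⟩
  cases w with
  | nil => exact i.elim0
  | cons k w =>
    obtain rfl : i = Fin.last w.length := Fin.ext (by simpa using hi)
    simpa using (admissibleWord_cons.1 hw).1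

theorem tendsto_mhs_zetaWord {w : List ℕ} (hw : AdmissibleWord w) :
    Tendsto (mhs w) atTop (𝓝 (zetaWord w)) := by
  have hrev : (List.ofFn fun i : Fin w.length => w.get i.rev).reverse = w := by
    refine List.ext_getElem (by simp) fun i _ _ => ?_
    simp only [List.getElem_reverse, List.getElem_ofFn, List.get_eq_getElem, Fin.val_rev,
      List.length_ofFn]
    congr 1
    lia
  simpa only [hrev, zetaWord] using tendsto_mhs_zeta (admissible_get_rev hw)

/-- The `ℚ[π²]`-module spanned by the multiple zeta values of depth at most `r`. -/
noncomputable abbrev depthSpan (r : ℕ) : Submodule ratPiSq ℝ :=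
  Submodule.span ratPiSq (valuesOfDepthLE r)

theorem zetaWord_mem_depthSpan {w : List ℕ} (hw : AdmissibleWord w) {r : ℕ} (hr : w.length ≤ r) :
    zetaWord w ∈ depthSpan r :=
  Submodule.subset_span ⟨w.length, _, hr, admissible_get_rev hw, rfl⟩

theorem depthSpan_mono : Monotone depthSpan := by
  rintro r s h
  refine Submodule.span_mono ?_
  rintro x ⟨e, l, he, hl, rfl⟩
  exact ⟨e, l, he.trans h, hl, rfl⟩

theorem one_mem_depthSpan (r : ℕ) : (1 : ℝ) ∈ depthSpan r :=
  Submodule.subset_span ⟨0, Fin.elim0, Nat.zero_le _, ⟨fun i => i.elim0, fun i => i.elim0⟩,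
    (zeta_empty _).symm⟩

theorem mem_depthSpan_of_mem_ratPiSq {x : ℝ} (hx : x ∈ ratPiSq) (r : ℕ) : x ∈ depthSpan r := by
  simpa [Subalgebra.smul_def] using
    (depthSpan r).smul_mem (⟨x, hx⟩ : ratPiSq) (one_mem_depthSpan r)

theorem zeta_mul_zeta_mem_depthSpan {d e : ℕ} {k : Fin d → ℕ} {l : Fin e → ℕ}
    (hk : Admissible k) (hl : Admissible l) : zeta k * zeta l ∈ depthSpan (d + e) := by
  set u := (List.ofFn k).reverse with hu
  set v := (List.ofFn l).reverse with hv
  have hadm {c : List ℕ} (hc : c ∈ stuffle u v) : AdmissibleWord c :=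
    (admissibleWord_reverse_ofFn hk).of_mem_stuffle (admissibleWord_reverse_ofFn hl) hc
  have hprod : Tendsto (fun N => mhs u N * mhs v N) atTop (𝓝 (zeta k * zeta l)) :=
    (tendsto_mhs_zeta hk).mul (tendsto_mhs_zeta hl)
  have hsum : Tendsto (fun N => mhs u N * mhs v N) atTop
      (𝓝 ((stuffle u v).map zetaWord).sum) := by
    simp only [mhs_mul]
    exact tendsto_list_sum _ fun c hc => tendsto_mhs_zetaWord (hadm hc)
  rw [tendsto_nhds_unique hprod hsum]
  refine list_sum_mem fun x hx => ?_
  obtain ⟨c, hc, rfl⟩ := List.mem_map.1 hx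
  exact zetaWord_mem_depthSpan (hadm hc) (by simpa [hu, hv] using length_le_of_mem_stuffle hc)

theorem mul_mem_depthSpan {r s : ℕ} {x y : ℝ} (hx : x ∈ depthSpan r) (hy : y ∈ depthSpan s) :
    x * y ∈ depthSpan (r + s) := by
  have hle : depthSpan r * depthSpan s ≤ depthSpan (r + s) := by
    rw [Submodule.span_mul_span, Submodule.span_le]
    rintro _ ⟨_, ⟨d, k, hd, hk, rfl⟩, _, ⟨e, l, he, hl, rfl⟩, rfl⟩
    exact depthSpan_mono (add_le_add hd he) (zeta_mul_zeta_mem_depthSpan hk hl)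
  exact hle (Submodule.mul_mem_mul hx hy)

/-- The sequences that are, up to `errors`, polynomials in the harmonic numbers whose coefficients
are `ℚ[π²]`-linear combinations of multiple zeta values of depth at most `r`. -/
noncomputable def regular (r : ℕ) : Submodule ℚ (ℕ → ℝ) where
  carrier := {a | ∃ p : Polynomial ℝ, (∀ i, p.coeff i ∈ depthSpan r) ∧
    a - aeval (mhs [1]) p ∈ errors}
  add_mem' := by
    rintro a b ⟨p, hp, ha⟩ ⟨q, hq, hb⟩
    refine ⟨p + q, fun i => ?_, ?_⟩
    · rw [Polynomial.coeff_add]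
      exact add_mem (hp i) (hq i)
    · rw [map_add, add_sub_add_comm]
      exact add_mem ha hb
  zero_mem' := ⟨0, by simp, by simp⟩
  smul_mem' := by
    rintro c a ⟨p, hp, ha⟩
    refine ⟨(c : ℝ) • p, fun i => ?_, ?_⟩
    · rw [Polynomial.coeff_smul, Rat.cast_smul_eq_qsmul]
      exact Submodule.smul_of_tower_mem _ c (hp i)
    · rw [map_smul, ← Rat.cast_smul_eq_qsmul ℝ, ← smul_sub]
      exact errors.smul_mem _ ha

theorem regular_mono : Monotone regular := by
  rintro r s h a ⟨p, hp, he⟩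
  exact ⟨p, fun i => depthSpan_mono h (hp i), he⟩

theorem mem_regular_of_mem_errors {e : ℕ → ℝ} (he : e ∈ errors) (r : ℕ) : e ∈ regular r :=
  ⟨0, by simp, by simpa using he⟩

theorem const_mem_regular {r : ℕ} {x : ℝ} (hx : x ∈ depthSpan r) : (fun _ => x) ∈ regular r := by
  refine ⟨Polynomial.C x, fun i => ?_, ?_⟩
  · rw [Polynomial.coeff_C]
    split_ifs
    exacts [hx, zero_mem _]
  · rw [Polynomial.aeval_C, Pi.algebraMap_def]
    simp

theorem aeval_mhs_one_mem_logBounded (p : Polynomial ℝ) : aeval (mhs [1]) p ∈ logBounded id :=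
  Algebra.adjoin_le (Set.singleton_subset_iff.2 (mhs_mem_logBounded (by simp)))
    (Polynomial.aeval_mem_adjoin_singleton ℝ _)

theorem mem_logBounded_of_mem_regular {r : ℕ} {a : ℕ → ℝ} (ha : a ∈ regular r) :
    a ∈ logBounded id := by
  obtain ⟨p, -, he⟩ := ha
  simpa using add_mem (mem_logBounded_of_mem_errors he) (aeval_mhs_one_mem_logBounded p)

theorem mul_mem_regular {r s : ℕ} {a b : ℕ → ℝ} (ha : a ∈ regular r) (hb : b ∈ regular s) :
    a * b ∈ regular (r + s) := by
  have hb' := mem_logBounded_of_mem_regular hb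
  obtain ⟨p, hp, he⟩ := ha
  obtain ⟨q, hq, hf⟩ := hb
  refine ⟨p * q, fun i => ?_, ?_⟩
  · rw [Polynomial.coeff_mul]
    exact sum_mem fun x _ => mul_mem_depthSpan (hp _) (hq _)
  · rw [map_mul, show a * b - aeval (mhs [1]) p * aeval (mhs [1]) q =
      (a - aeval (mhs [1]) p) * b + (b - aeval (mhs [1]) q) * aeval (mhs [1]) p by ring]
    exact add_mem (mul_mem_logDominated he hb')
      (mul_mem_logDominated hf (aeval_mhs_one_mem_logBounded p))

theorem mhs_one_mem_regular : mhs [1] ∈ regular 0 := by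
  refine ⟨Polynomial.X, fun i => ?_, by simp⟩
  rw [Polynomial.coeff_X]
  split_ifs
  exacts [one_mem_depthSpan 0, zero_mem _]

theorem list_sum_mhs_mem_regular {r : ℕ} {T : List (List ℕ)} (h : ∀ c ∈ T, mhs c ∈ regular r) :
    (fun N => (T.map (mhs · N)).sum) ∈ regular r := by
  convert list_sum_mem (List.forall_mem_map.2 h) using 1
  ext N
  rw [Pi.list_sum_apply, List.map_map]
  rfl

theorem mhs_mem_regular_of_admissibleWord {w : List ℕ} (hw : AdmissibleWord w) :
    mhs w ∈ regular w.length := by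
  convert (regular w.length).add_mem (const_mem_regular (zetaWord_mem_depthSpan hw le_rfl))
    (mem_regular_of_mem_errors (mhs_sub_mem_errors hw (tendsto_mhs_zetaWord hw)) _) using 1
  ext N
  simp

theorem mhs_ones_append_mem_regular (s : ℕ) {v : List ℕ} (hv : AdmissibleWord v) :
    mhs (List.replicate s 1 ++ v) ∈ regular (s + v.length) := by
  induction s using Nat.strong_induction_on generalizing v with
  | _ s ih =>
    rcases s with _ | s
    · simpa using mhs_mem_regular_of_admissibleWord hv
    have hprod : mhs [1] * mhs (List.replicate s 1 ++ v) ∈ regular (s + 1 + v.length) :=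
      regular_mono (by lia) (mul_mem_regular mhs_one_mem_regular (ih s (by lia) hv))
    have hrem : (fun N => ((harmonicRemainder s v).map (mhs · N)).sum) ∈
        regular (s + 1 + v.length) := by
      refine list_sum_mhs_mem_regular fun c hc => ?_
      obtain ⟨i, x, rfl, hi, hx, hlen⟩ := exists_of_mem_harmonicRemainder hv hc
      exact regular_mono hlen (ih i (by lia) hx)
    convert (regular _).smul_mem (s + 1 : ℚ)⁻¹ ((regular _).sub_mem hprod hrem) using 1
    ext N
    simp only [Pi.smul_apply, Pi.sub_apply, Pi.mul_apply, mhs_one_mul_mhs_ones_append,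
      add_sub_cancel_right, Rat.smul_def]
    push_cast
    field_simp

theorem exists_eq_replicate_append {w : List ℕ} (hw : ∀ x ∈ w, 1 ≤ x) :
    ∃ s v, w = List.replicate s 1 ++ v ∧ AdmissibleWord v := by
  induction w with
  | nil => exact ⟨0, [], rfl, admissibleWord_nil⟩
  | cons k w ih =>
    rw [List.forall_mem_cons] at hw
    rcases eq_or_ne k 1 with rfl | hk
    · obtain ⟨s, v, rfl, hv⟩ := ih hw.2
      exact ⟨s + 1, v, rfl, hv⟩
    · exact ⟨0, k :: w, rfl, admissibleWord_cons.2 ⟨by lia, hw.2⟩⟩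

theorem mhs_mem_regular {w : List ℕ} (hw : ∀ x ∈ w, 1 ≤ x) : mhs w ∈ regular w.length := by
  obtain ⟨s, v, rfl, hv⟩ := exists_eq_replicate_append hw
  simpa using mhs_ones_append_mem_regular s hv

theorem mem_depthSpan_of_const_mem_regular {r : ℕ} {x : ℝ} (h : (fun _ => x) ∈ regular r) :
    x ∈ depthSpan r := by
  obtain ⟨p, hp, he⟩ := h
  have hlim : Tendsto (fun N => p.eval (mhs [1] N)) atTop (𝓝 x) := by
    simpa [Polynomial.aeval_fn_apply] using (tendsto_zero_of_mem_errors he).const_sub x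
  -- a polynomial in the divergent harmonic numbers converges only if it is constant
  have hdeg : p.degree ≤ 0 := by
    by_contra! hd
    exact not_tendsto_nhds_of_tendsto_atTop
      ((p.abs_tendsto_atTop hd).comp tendsto_mhs_one_atTop) _ hlim.abs
  rw [Polynomial.eq_C_of_degree_le_zero hdeg] at hlim
  simp only [Polynomial.eval_C] at hlim
  rw [← tendsto_nhds_unique tendsto_const_nhds hlim]
  exact hp 0

end Values

section TwoSided

theorem diagonal_mem_regular {d : ℕ} {E : ℕ → ℕ → ℝ} (hE : E ∈ Submodule.span ℚ (twoSided d)) :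
    (fun N => E N N) ∈ regular d := by
  let diagonal : (ℕ → ℕ → ℝ) →ₗ[ℚ] (ℕ → ℝ) :=
    { toFun E N := E N N, map_add' _ _ := rfl, map_smul' _ _ := rfl }
  suffices h : Submodule.span ℚ (twoSided d) ≤ (regular d).comap diagonal from h hE
  rw [Submodule.span_le]
  rintro _ ⟨v, u, rfl, hv, hu, rfl⟩
  exact mul_mem_regular (mhs_mem_regular hv.1) (mhs_mem_regular hu)

/-- The functions of `(N, n)` that are `O(n / N)`, up to powers of the logarithm: the relative size
of a perturbation of `N` by `n`. -/
noncomputable abbrev perturbationErrors : Submodule ℝ (ℕ × ℕ → ℝ) :=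
  logDominated (fun x => x.1 + x.2) fun x => (x.1 : ℝ) / x.2

theorem mhs_comp_sub_mem_perturbationErrors {w : List ℕ} (hw : ∀ x ∈ w, 1 ≤ x) {φ : ℕ × ℕ → ℕ}
    (hφ : ∀ x, φ x ≤ x.1 + x.2) (hφ' : ∀ x, x.1 ≤ φ x + x.2) :
    (fun x => mhs w (φ x) - mhs w x.1) ∈ perturbationErrors := by
  refine ⟨1, w.length, zero_le_one, fun x => ?_⟩
  obtain ⟨lo, hi, hlohi, hxhi, hhi, hdist, habs⟩ : ∃ lo hi : ℕ, lo ≤ hi ∧ x.1 ≤ hi ∧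
      hi ≤ x.1 + x.2 ∧ hi ≤ lo + x.2 ∧ |mhs w (φ x) - mhs w x.1| = mhs w hi - mhs w lo := by
    rcases le_total x.1 (φ x) with h | h
    · exact ⟨x.1, φ x, h, h, hφ x, hφ x, abs_of_nonneg (sub_nonneg.2 (mhs_mono w h))⟩
    · exact ⟨φ x, x.1, h, le_rfl, Nat.le_add_right _ _, hφ' x, by
        rw [abs_sub_comm, abs_of_nonneg (sub_nonneg.2 (mhs_mono w h))]⟩
  have hpow : 0 ≤ logScale (x.1 + x.2) ^ w.length := pow_nonneg (logScale_nonneg _) _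
  have hmul : (x.1 : ℝ) * (mhs w hi - mhs w lo) ≤ logScale (x.1 + x.2) ^ w.length * x.2 :=
    calc (x.1 : ℝ) * (mhs w hi - mhs w lo) ≤ hi * (mhs w hi - mhs w lo) := by
          gcongr
          exact sub_nonneg.2 (mhs_mono w hlohi)
      _ ≤ (hi - lo) * logScale hi ^ w.length := mul_mhs_sub_le hw hlohi
      _ ≤ x.2 * logScale (x.1 + x.2) ^ w.length := by
          gcongr
          · exact pow_nonneg (logScale_nonneg _) _
          · rw [sub_le_iff_le_add']
            exact_mod_cast hdist
          · exact logScale_nonneg _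
          · exact logScale_mono hhi
      _ = _ := mul_comm _ _
  rw [one_mul, LinearMap.mulLeft_apply, Pi.mul_apply, abs_mul, habs, abs_of_nonneg (by positivity),
    div_mul_eq_mul_div]
  exact div_le_of_le_mul₀ (Nat.cast_nonneg _) hpow hmul

theorem comp_sub_diagonal_mem_perturbationErrors {d : ℕ} {E : ℕ → ℕ → ℝ}
    (hE : E ∈ Submodule.span ℚ (twoSided d)) {φ ψ : ℕ × ℕ → ℕ}
    (hφ : ∀ x, φ x ≤ x.1 + x.2) (hφ' : ∀ x, x.1 ≤ φ x + x.2)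
    (hψ : ∀ x, ψ x ≤ x.1 + x.2) (hψ' : ∀ x, x.1 ≤ ψ x + x.2) :
    (fun x => E (φ x) (ψ x) - E x.1 x.1) ∈ perturbationErrors := by
  let difference : (ℕ → ℕ → ℝ) →ₗ[ℚ] (ℕ × ℕ → ℝ) :=
    { toFun E x := E (φ x) (ψ x) - E x.1 x.1
      map_add' _ _ := by ext; simp only [Pi.add_apply]; ring
      map_smul' _ _ := by ext; simp only [Pi.smul_apply, smul_sub, RingHom.id_apply] }
  suffices h : Submodule.span ℚ (twoSided d) ≤
    (perturbationErrors.restrictScalars ℚ).comap difference from h hE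
  rw [Submodule.span_le]
  rintro _ ⟨v, u, -, hv, hu, rfl⟩
  have hsum := add_mem
    (mul_mem_logDominated (mhs_comp_sub_mem_perturbationErrors hv.1 hψ hψ')
      (comp_mem_logBounded (mhs_mem_logBounded hu) hφ))
    (mul_mem_logDominated (mhs_comp_sub_mem_perturbationErrors hu hφ hφ')
      (comp_mem_logBounded (mhs_mem_logBounded hv.1) fun x => Nat.le_add_right x.1 x.2))
  change difference _ ∈ perturbationErrors
  convert hsum using 1
  ext x
  simp only [difference, LinearMap.coe_mk, AddHom.coe_mk, Pi.add_apply, Pi.mul_apply,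
    Function.comp_apply]
  ring

/-- The functions of `(A, B)` that are `O(min A B ^ (-1/2))`, up to powers of the logarithm. -/
noncomputable abbrev pairErrors : Submodule ℝ (ℕ × ℕ → ℝ) :=
  logDominated (fun x => max x.1 x.2) fun x => √((min x.1 x.2 : ℕ) : ℝ)

theorem comp_fst_mem_pairErrors {e : ℕ → ℝ} (he : e ∈ errors) :
    (fun x : ℕ × ℕ => e x.1) ∈ pairErrors :=
  comp_mem_logDominated he (fun x => le_max_left x.1 x.2) fun x =>
    abs_le_abs_of_nonneg (Real.sqrt_nonneg _) (Real.sqrt_le_sqrt (by simp))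

theorem comp_snd_mem_pairErrors {e : ℕ → ℝ} (he : e ∈ errors) :
    (fun x : ℕ × ℕ => e x.2) ∈ pairErrors :=
  comp_mem_logDominated he (fun x => le_max_right x.1 x.2) fun x =>
    abs_le_abs_of_nonneg (Real.sqrt_nonneg _) (Real.sqrt_le_sqrt (by simp))

theorem exists_sub_eval_mem_pairErrors {d : ℕ} {E : ℕ → ℕ → ℝ}
    (hE : E ∈ Submodule.span ℚ (twoSided d)) :
    ∃ q : Polynomial ℝ, (fun x : ℕ × ℕ => E x.1 x.2 - q.eval (mhs [1] x.1)) ∈ pairErrors := by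
  let uncurry : (ℕ → ℕ → ℝ) →ₗ[ℚ] (ℕ × ℕ → ℝ) :=
    { toFun E x := E x.1 x.2, map_add' _ _ := rfl, map_smul' _ _ := rfl }
  let evalHarmonic : Polynomial ℝ →ₗ[ℝ] (ℕ × ℕ → ℝ) :=
    LinearMap.pi fun x => Polynomial.leval (mhs [1] x.1)
  suffices h : Submodule.span ℚ (twoSided d) ≤
      ((pairErrors ⊔ LinearMap.range evalHarmonic).restrictScalars ℚ).comap uncurry by
    obtain ⟨e, he, _, ⟨q, rfl⟩, heq⟩ := Submodule.mem_sup.1 (h hE)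
    obtain rfl := eq_sub_of_add_eq heq
    exact ⟨q, he⟩
  rw [Submodule.span_le]
  rintro _ ⟨v, u, -, hv, hu, rfl⟩
  obtain ⟨q, -, hq⟩ := mhs_mem_regular hu
  have hz := mhs_sub_mem_errors hv (tendsto_mhs_zetaWord hv)
  refine Submodule.mem_sup.2 ⟨_, add_mem
    (mul_mem_logDominated (comp_snd_mem_pairErrors hz)
      (comp_mem_logBounded (mhs_mem_logBounded hu) fun x => le_max_left x.1 x.2))
    (pairErrors.smul_mem (zetaWord v) (comp_fst_mem_pairErrors hq)),
    _, ⟨zetaWord v • q, rfl⟩, ?_⟩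
  ext x
  simp only [uncurry, evalHarmonic, LinearMap.coe_mk, AddHom.coe_mk, LinearMap.pi_apply, map_smul,
    Polynomial.leval_apply, Polynomial.aeval_fn_apply, Polynomial.coe_aeval_eq_eval, Pi.add_apply,
    Pi.sub_apply, Pi.mul_apply, Pi.smul_apply, Function.comp_apply, smul_eq_mul]
  ring

end TwoSided

section SymmetricSums

theorem sum_mul_mem_errors {f ω : ℕ × ℕ → ℝ} {a : ℕ → ℝ}
    (hf : f ∈ logDominated (fun x => x.1 + x.2) ω) (ha : ∀ n, 0 ≤ a n)
    (hω : ∀ N, ∀ n ∈ Ico 1 N, 0 < ω (N, n))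
    (hsum : (fun N : ℕ => ∑ n ∈ Ico 1 N, a n * (ω (N, n))⁻¹) ∈ errors) :
    (fun N : ℕ => ∑ n ∈ Ico 1 N, a n * f (N, n)) ∈ errors := by
  obtain ⟨C, p, hC, hf⟩ := hf
  obtain ⟨D, q, hD, hsum⟩ := mem_errors.1 hsum
  refine mem_errors.2 ⟨D * (C * 2 ^ p), q + p, by positivity, fun N hN => ?_⟩
  have hterm {n : ℕ} (hn : n ∈ Ico 1 N) :
      |f (N, n)| ≤ (ω (N, n))⁻¹ * (C * (2 * logScale N) ^ p) := by
    rw [← div_eq_inv_mul, le_div_iff₀ (hω N n hn), mul_comm]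
    have hfn := hf (N, n)
    rw [LinearMap.mulLeft_apply, Pi.mul_apply, abs_mul, abs_of_pos (hω N n hn)] at hfn
    refine hfn.trans ?_
    gcongr
    · exact logScale_nonneg _
    · exact (logScale_mono (by have := (Finset.mem_Ico.1 hn).2; lia)).trans
        (logScale_two_mul_le N)
  calc √(N : ℝ) * |∑ n ∈ Ico 1 N, a n * f (N, n)|
      ≤ √(N : ℝ) * ∑ n ∈ Ico 1 N, a n * ((ω (N, n))⁻¹ * (C * (2 * logScale N) ^ p)) := by
        gcongr
        refine (Finset.abs_sum_le_sum_abs _ _).trans (Finset.sum_le_sum fun n hn => ?_)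
        rw [abs_mul, abs_of_nonneg (ha n)]
        exact mul_le_mul_of_nonneg_left (hterm hn) (ha n)
    _ = (√(N : ℝ) * ∑ n ∈ Ico 1 N, a n * (ω (N, n))⁻¹) * (C * (2 * logScale N) ^ p) := by
        simp only [← mul_assoc, ← Finset.sum_mul]
    _ ≤ (D * logScale N ^ q) * (C * (2 * logScale N) ^ p) := by
        have := logScale_nonneg N
        refine mul_le_mul_of_nonneg_right ?_ (by positivity)
        exact (mul_le_mul_of_nonneg_left (le_abs_self _) (Real.sqrt_nonneg _)).trans (hsum N hN)
    _ = D * (C * 2 ^ p) * logScale N ^ (q + p) := by rw [mul_pow, pow_add]; ring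

theorem mhs_one_le_logScale (N : ℕ) : mhs [1] N ≤ logScale N := le_add_of_nonneg_left zero_le_one

theorem sum_inv_pow_mul_mem_errors {s : ℕ} (hs : 2 ≤ s) {f : ℕ × ℕ → ℝ}
    (hf : f ∈ perturbationErrors) :
    (fun N : ℕ => ∑ n ∈ Ico 1 N, ((n : ℝ) ^ s)⁻¹ * f (N, n)) ∈ errors := by
  refine sum_mul_mem_errors hf (fun n => by positivity) (fun N n hn => ?_)
    (mem_errors.2 ⟨1, 1, zero_le_one, fun N hN => ?_⟩)
  · obtain ⟨hn, hnN⟩ := Finset.mem_Ico.1 hn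
    have : 0 < N := by lia
    positivity
  have hsqrt : √(N : ℝ) ≤ N := Real.sqrt_le_self_iff.2 (.inr (by exact_mod_cast hN))
  have hterm (n : ℕ) (hn : n ∈ Ico 1 N) :
      ((n : ℝ) ^ s)⁻¹ * ((N : ℝ) / n)⁻¹ ≤ (N : ℝ)⁻¹ * (n : ℝ)⁻¹ := by
    have hn0 : (n : ℝ) ≠ 0 := by have := (Finset.mem_Ico.1 hn).1; positivity
    calc ((n : ℝ) ^ s)⁻¹ * ((N : ℝ) / n)⁻¹ = (N : ℝ)⁻¹ * ((n : ℝ) ^ (s - 1))⁻¹ := by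
          rw [show s = s - 1 + 1 by lia, pow_succ, Nat.add_sub_cancel]
          field_simp
      _ ≤ (N : ℝ)⁻¹ * (n : ℝ)⁻¹ :=
        mul_le_mul_of_nonneg_left (inv_pow_le_inv (by lia) n) (by positivity)
  rw [abs_of_nonneg (Finset.sum_nonneg fun n _ => by positivity), one_mul, pow_one]
  calc √(N : ℝ) * ∑ n ∈ Ico 1 N, ((n : ℝ) ^ s)⁻¹ * ((N : ℝ) / n)⁻¹
      ≤ N * ∑ n ∈ Ico 1 N, (N : ℝ)⁻¹ * (n : ℝ)⁻¹ :=
        mul_le_mul hsqrt (Finset.sum_le_sum hterm)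
          (Finset.sum_nonneg fun n _ => by positivity) (Nat.cast_nonneg N)
    _ = mhs [1] N := by rw [← Finset.mul_sum, ← mhs_one, mul_inv_cancel_left₀ (by positivity)]
    _ ≤ logScale N := mhs_one_le_logScale N

theorem exists_tendsto_mhs_even {j : ℕ} (hj : j ≠ 0) :
    ∃ z ∈ ratPiSq, Tendsto (mhs [2 * j]) atTop (𝓝 z) := by
  refine ⟨_, ?_, (hasSum_zeta_nat hj).tendsto_sum_nat.congr fun N => ?_⟩
  · have hpi : Real.pi ^ 2 ∈ ratPiSq := Algebra.subset_adjoin rfl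
    convert ratPiSq.smul_mem (pow_mem hpi j)
      ((-1 : ℚ) ^ (j + 1) * 2 ^ (2 * j - 1) * bernoulli (2 * j) / (2 * j).factorial) using 1
    rw [Rat.smul_def]
    push_cast
    ring
  · rw [mhs_cons_eq_sum_range (by lia)]
    simp only [one_div, mhs_nil, mul_one]

theorem one_add_neg_one_pow_mul_mhs_mem_regular {s : ℕ} (hs : 2 ≤ s) :
    (fun N => (1 + (-1) ^ s) * mhs [s] N) ∈ regular 0 := by
  rcases s.even_or_odd' with ⟨j, rfl | rfl⟩
  · obtain ⟨z, hz, hlim⟩ := exists_tendsto_mhs_even (j := j) (by lia)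
    have hmhs := (regular 0).add_mem
      (mem_regular_of_mem_errors (mhs_sub_mem_errors (admissibleWord_cons.2 ⟨hs, by simp⟩) hlim) 0)
      (const_mem_regular (mem_depthSpan_of_mem_ratPiSq hz 0))
    convert (regular 0).smul_mem 2 hmhs using 1
    ext N
    simp only [Pi.smul_apply, Pi.add_apply, Rat.smul_def, (even_two_mul j).neg_one_pow]
    push_cast
    ring
  · convert (regular 0).zero_mem using 1
    ext N
    simp [(odd_two_mul_add_one j).neg_one_pow]

theorem symSum_mem_regular {d s : ℕ} (hs : 2 ≤ s) {E : ℕ → ℕ → ℝ}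
    (hE : E ∈ Submodule.span ℚ (twoSided d)) : symSum s E ∈ regular d := by
  have hright := sum_inv_pow_mul_mem_errors hs (comp_sub_diagonal_mem_perturbationErrors hE
    (φ := fun x => x.1 + x.2) (ψ := fun x => x.1 - x.2) (by lia) (by lia) (by lia) (by lia))
  have hleft := sum_inv_pow_mul_mem_errors hs (comp_sub_diagonal_mem_perturbationErrors hE
    (φ := fun x => x.1 - x.2) (ψ := fun x => x.1 + x.2) (by lia) (by lia) (by lia) (by lia))
  have hmain : (fun N => (1 + (-1) ^ s) * mhs [s] N) * (fun N => E N N) ∈ regular d := by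
    simpa using mul_mem_regular (one_add_neg_one_pow_mul_mhs_mem_regular hs)
      (diagonal_mem_regular hE)
  convert (regular d).add_mem hmain (mem_regular_of_mem_errors
    (add_mem hright (errors.smul_mem ((-1) ^ s) hleft)) d) using 1
  ext N
  simp only [symSum, Pi.add_apply, Pi.mul_apply, Pi.smul_apply, smul_eq_mul, mhs_cons, mhs_nil,
    Finset.mul_sum, Finset.sum_mul, ← Finset.sum_add_distrib]
  exact Finset.sum_congr rfl fun n _ => by ring

theorem sum_Ico_one_reflect {M : Type*} [AddCommMonoid M] (g : ℕ → M) (N : ℕ) :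
    ∑ n ∈ Ico 1 N, g (N - n) = ∑ n ∈ Ico 1 N, g n := by
  simpa using Finset.sum_Ico_reflect g 1 N.le_succ

theorem sum_inv_mul_mem_errors {f : ℕ × ℕ → ℝ}
    (hf : f ∈ logDominated (fun x => x.1 + x.2) fun x => √((x.1 - x.2 : ℕ) : ℝ)) :
    (fun N : ℕ => ∑ n ∈ Ico 1 N, (n : ℝ)⁻¹ * f (N, n)) ∈ errors := by
  refine sum_mul_mem_errors hf (fun n => by positivity) (fun N n hn => ?_)
    (mem_errors.2 ⟨2, 1, zero_le_two, fun N _ => ?_⟩)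
  · have := (Finset.mem_Ico.1 hn).2
    exact Real.sqrt_pos.2 (by exact_mod_cast (by lia : 0 < N - n))
  have hterm (n : ℕ) (hn : n ∈ Ico 1 N) :
      √(N : ℝ) * ((n : ℝ)⁻¹ * (√((N - n : ℕ) : ℝ))⁻¹) ≤ (n : ℝ)⁻¹ + ((N - n : ℕ) : ℝ)⁻¹ := by
    obtain ⟨hn, hnN⟩ := Finset.mem_Ico.1 hn
    have : (0 : ℝ) < n := by exact_mod_cast hn
    have hm0 : (0 : ℝ) < (N - n : ℕ) := by exact_mod_cast (by lia : 0 < N - n)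
    have hle : √(N : ℝ) * (√((N - n : ℕ) : ℝ))⁻¹ ≤ N / (N - n : ℕ) := by
      rw [← div_eq_mul_inv, ← Real.sqrt_div (Nat.cast_nonneg N)]
      exact Real.sqrt_le_self_iff.2 (.inr ((one_le_div hm0).2 (by exact_mod_cast Nat.sub_le N n)))
    calc √(N : ℝ) * ((n : ℝ)⁻¹ * (√((N - n : ℕ) : ℝ))⁻¹)
        = (n : ℝ)⁻¹ * (√(N : ℝ) * (√((N - n : ℕ) : ℝ))⁻¹) := mul_left_comm _ _ _
      _ ≤ (n : ℝ)⁻¹ * (N / (N - n : ℕ)) := by gcongr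
      _ = (n : ℝ)⁻¹ + ((N - n : ℕ) : ℝ)⁻¹ := by
        rw [Nat.cast_sub hnN.le] at hm0 ⊢
        field_simp
        ring
  rw [abs_of_nonneg (Finset.sum_nonneg fun n _ => by positivity), Finset.mul_sum, pow_one, two_mul]
  calc ∑ n ∈ Ico 1 N, √(N : ℝ) * ((n : ℝ)⁻¹ * (√((N - n : ℕ) : ℝ))⁻¹)
      ≤ ∑ n ∈ Ico 1 N, ((n : ℝ)⁻¹ + ((N - n : ℕ) : ℝ)⁻¹) := Finset.sum_le_sum hterm
    _ = mhs [1] N + mhs [1] N := by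
      rw [Finset.sum_add_distrib, sum_Ico_one_reflect fun m => (m : ℝ)⁻¹, mhs_one]
    _ ≤ logScale N + logScale N := add_le_add (mhs_one_le_logScale N) (mhs_one_le_logScale N)

theorem sum_inv_sqrt_le (N : ℕ) : ∑ m ∈ Ico 1 N, (√(m : ℝ))⁻¹ ≤ 3 * √(N : ℝ) := by
  rcases Nat.eq_zero_or_pos N with rfl | hN
  · simp
  calc ∑ m ∈ Ico 1 N, (√(m : ℝ))⁻¹ ≤ ∑ m ∈ Ico 1 N, 3 * (√((m + 1 : ℕ) : ℝ) - √(m : ℝ)) :=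
        Finset.sum_le_sum fun m hm => inv_sqrt_le (Finset.mem_Ico.1 hm).1
    _ = 3 * (√(N : ℝ) - √((1 : ℕ) : ℝ)) := by
        rw [← Finset.mul_sum, Finset.sum_Ico_sub (fun m : ℕ => √(m : ℝ)) hN]
    _ ≤ 3 * √(N : ℝ) := by simp

theorem tendsto_mean_of_mem_pairErrors {e : ℕ × ℕ → ℝ} (he : e ∈ pairErrors) :
    Tendsto (fun M : ℕ => (∑ A ∈ Ico 1 M, e (A, M - A)) / M) atTop (𝓝 0) := by
  obtain ⟨C, p, hC, he⟩ := he
  have hterm {M A : ℕ} (hA : A ∈ Ico 1 M) :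
      |e (A, M - A)| ≤ C * logScale M ^ p * ((√(A : ℝ))⁻¹ + (√((M - A : ℕ) : ℝ))⁻¹) := by
    obtain ⟨hA, hAM⟩ := Finset.mem_Ico.1 hA
    have hmin : 0 < √((min A (M - A) : ℕ) : ℝ) := Real.sqrt_pos.2 (by exact_mod_cast (by lia))
    have hbound := he (A, M - A)
    rw [LinearMap.mulLeft_apply, Pi.mul_apply, abs_mul, abs_of_pos hmin, mul_comm,
      ← le_div_iff₀ hmin, div_eq_mul_inv] at hbound
    refine hbound.trans ?_
    gcongr
    · exact mul_nonneg hC (pow_nonneg (logScale_nonneg M) p)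
    · exact logScale_nonneg _
    · exact logScale_mono (max_le hAM.le (Nat.sub_le M A))
    · rcases min_choice A (M - A) with h | h <;> rw [h]
      exacts [le_add_of_nonneg_right (by positivity), le_add_of_nonneg_left (by positivity)]
  refine squeeze_zero_norm (fun M => ?_) (tendsto_logScale_pow_div_sqrt (6 * C) p)
  have hscale := logScale_nonneg M
  have hsum : |∑ A ∈ Ico 1 M, e (A, M - A)| ≤ C * logScale M ^ p * (6 * √(M : ℝ)) :=
    calc |∑ A ∈ Ico 1 M, e (A, M - A)|
        ≤ ∑ A ∈ Ico 1 M, C * logScale M ^ p * ((√(A : ℝ))⁻¹ + (√((M - A : ℕ) : ℝ))⁻¹) :=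
          (Finset.abs_sum_le_sum_abs _ _).trans (Finset.sum_le_sum fun A hA => hterm hA)
      _ = C * logScale M ^ p * (2 * ∑ A ∈ Ico 1 M, (√(A : ℝ))⁻¹) := by
          rw [← Finset.mul_sum, Finset.sum_add_distrib,
            sum_Ico_one_reflect fun m => (√(m : ℝ))⁻¹, two_mul]
      _ ≤ C * logScale M ^ p * (6 * √(M : ℝ)) := by
          refine mul_le_mul_of_nonneg_left ?_ (by positivity)
          linarith [sum_inv_sqrt_le M]
  rw [norm_div, Real.norm_eq_abs, Real.norm_natCast]
  calc |∑ A ∈ Ico 1 M, e (A, M - A)| / M ≤ C * logScale M ^ p * (6 * √(M : ℝ)) / M := by gcongr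
    _ = 6 * C * logScale M ^ p * (√(M : ℝ) / M) := by ring
    _ = 6 * C * logScale M ^ p / √(M : ℝ) := by rw [Real.sqrt_div_self, div_eq_mul_inv]

theorem nonpos_of_tendsto_mean {u : ℕ → ℝ} {c : ℝ} (hu : ∀ᶠ A in atTop, c ≤ u A) {φ : ℕ → ℕ}
    (hφ : Tendsto φ atTop atTop)
    (hmean : Tendsto (fun N => (∑ A ∈ Ico 1 (φ N), u A) / φ N) atTop (𝓝 0)) : c ≤ 0 := by
  let v (A : ℕ) : ℝ := if A = 0 then 0 else min (u A) c
  have hv : Tendsto v atTop (𝓝 c) := by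
    refine tendsto_const_nhds.congr' ?_
    filter_upwards [hu, eventually_ne_atTop 0] with A hA hA0
    rw [show v A = min (u A) c from if_neg hA0, min_eq_right hA]
  refine le_of_tendsto_of_tendsto' (hv.cesaro.comp hφ) hmean fun N => ?_
  rw [Function.comp_apply, ← div_eq_inv_mul]
  gcongr
  have hzero : ∑ A ∈ Ico 1 (φ N), v A = ∑ A ∈ range (φ N), v A := by
    rw [Finset.range_eq_Ico]
    refine Finset.sum_subset (Finset.Ico_subset_Ico_left zero_le_one) fun A hA hA' => if_pos ?_
    simp only [Finset.mem_Ico] at hA hA'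
    lia
  rw [← hzero]
  exact Finset.sum_le_sum fun A hA =>
    (if_neg (Nat.one_le_iff_ne_zero.1 (Finset.mem_Ico.1 hA).1)).trans_le (min_le_left _ _)

theorem exists_pos_le_eval {q : Polynomial ℝ} (hq : 0 < q.leadingCoeff) :
    ∃ c, 0 < c ∧ ∀ᶠ x in atTop, c ≤ q.eval x := by
  rcases le_or_gt q.degree 0 with hdeg | hdeg
  · refine ⟨q.leadingCoeff, hq, Eventually.of_forall fun x => ?_⟩
    rw [Polynomial.eq_C_of_degree_le_zero hdeg]
    simp
  · exact ⟨1, one_pos,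
      (q.tendsto_atTop_of_leadingCoeff_nonneg hdeg hq.le).eventually_ge_atTop 1⟩

theorem leadingCoeff_nonpos_of_tendsto_mean {q : Polynomial ℝ} {φ : ℕ → ℕ}
    (hφ : Tendsto φ atTop atTop)
    (hmean : Tendsto (fun N => (∑ A ∈ Ico 1 (φ N), q.eval (mhs [1] A)) / φ N) atTop (𝓝 0)) :
    q.leadingCoeff ≤ 0 := by
  by_contra! hq
  obtain ⟨c, hc, hle⟩ := exists_pos_le_eval hq
  exact hc.not_ge (nonpos_of_tendsto_mean (u := fun A => q.eval (mhs [1] A))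
    (tendsto_mhs_one_atTop.eventually hle) hφ hmean)

theorem eq_zero_of_tendsto_mean {q : Polynomial ℝ} {φ : ℕ → ℕ} (hφ : Tendsto φ atTop atTop)
    (hmean : Tendsto (fun N => (∑ A ∈ Ico 1 (φ N), q.eval (mhs [1] A)) / φ N) atTop (𝓝 0)) :
    q = 0 := by
  have hneg : (-q).leadingCoeff ≤ 0 := leadingCoeff_nonpos_of_tendsto_mean hφ (by
    simpa [Finset.sum_neg_distrib, neg_div] using hmean.neg)
  rw [Polynomial.leadingCoeff_neg, neg_nonpos] at hneg
  exact Polynomial.leadingCoeff_eq_zero.1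
    ((leadingCoeff_nonpos_of_tendsto_mean hφ hmean).antisymm hneg)

theorem mem_pairErrors_of_sum_eq_zero {d : ℕ} {E : ℕ → ℕ → ℝ}
    (hE : E ∈ Submodule.span ℚ (twoSided d))
    (hzero : ∀ N, ∑ A ∈ Ico 1 (2 * N), E A (2 * N - A) = 0) :
    (fun x => E x.1 x.2) ∈ pairErrors := by
  obtain ⟨q, hq⟩ := exists_sub_eval_mem_pairErrors hE
  have hφ : Tendsto (fun N => 2 * N) atTop atTop := tendsto_id.const_mul_atTop' two_pos
  have hq0 : q = 0 := eq_zero_of_tendsto_mean hφ (by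
    simpa [Finset.sum_sub_distrib, hzero, neg_div] using
      ((tendsto_mean_of_mem_pairErrors hq).comp hφ).neg)
  simpa [hq0] using hq

theorem symSum_one_mem_errors {d : ℕ} {E : ℕ → ℕ → ℝ} (hE : E ∈ Submodule.span ℚ (twoSided d))
    (hzero : ∀ N, ∑ A ∈ Ico 1 (2 * N), E A (2 * N - A) = 0) : symSum 1 E ∈ errors := by
  have hpair := mem_pairErrors_of_sum_eq_zero hE hzero
  have hright := sum_inv_mul_mem_errors (comp_mem_logDominated hpair
    (φ := fun x => (x.1 + x.2, x.1 - x.2)) (by dsimp only; lia) fun x =>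
      abs_le_abs_of_nonneg (Real.sqrt_nonneg _)
        (Real.sqrt_le_sqrt (Nat.cast_le.2 (by dsimp only; lia))))
  have hleft := sum_inv_mul_mem_errors (comp_mem_logDominated hpair
    (φ := fun x => (x.1 - x.2, x.1 + x.2)) (by dsimp only; lia) fun x =>
      abs_le_abs_of_nonneg (Real.sqrt_nonneg _)
        (Real.sqrt_le_sqrt (Nat.cast_le.2 (by dsimp only; lia))))
  convert sub_mem hright hleft using 1
  ext N
  simp only [symSum, pow_one, neg_one_mul, ← sub_eq_add_neg, mul_sub, Finset.sum_sub_distrib,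
    Pi.sub_apply, Function.comp_apply]

end SymmetricSums

section Parity

/-- The sum of `∏ nᵢ ^ (-kᵢ)` over the nonzero integers `-N < n₁ < ⋯ < n_d < N`. -/
noncomputable def bilateral (w : List ℕ) (N : ℕ) : ℝ :=
  conv (mhs · N) (fun u => chain powInv u (-N) 0) w

theorem regular_congr {r : ℕ} {a b : ℕ → ℝ} (ha : a ∈ regular r)
    (h : ∀ N, 1 ≤ N → a N = b N) : b ∈ regular r := by
  have hdiff : b - a ∈ errors := mem_errors.2 ⟨0, 0, le_rfl, fun N hN => by simp [h N hN]⟩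
  simpa using (regular r).add_mem ha (mem_regular_of_mem_errors hdiff r)

theorem symSum_finset_sum {ι : Type*} (t : Finset ι) (E : ι → ℕ → ℕ → ℝ) (s N : ℕ) :
    symSum s (∑ i ∈ t, E i) N = ∑ i ∈ t, symSum s (E i) N := by
  simp only [symSum, Finset.sum_apply, Finset.mul_sum, ← Finset.sum_add_distrib]
  exact Finset.sum_comm

theorem bilateral_eq {w : List ℕ} (hw : ∀ x ∈ w, 1 ≤ x) (hsum : 1 ≤ w.sum) {N : ℕ} (hN : 1 ≤ N) :
    bilateral w N =
      ∑ i : Fin w.length, ∑ j ∈ range (w[i] - 1), symSum (j + 2) (gapCoeff w i (w[i] - 2 - j)) N +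
        symSum 1 (∑ i : Fin w.length, gapCoeff w i (w[i] - 1)) N -
        ∑ i : Fin w.length, gapCoeff w i w[i] N N := by
  rw [bilateral, eq_sub_iff_add_eq, conv_chain_add_sum_gapCoeff hsum hN, symSum_finset_sum,
    ← Finset.sum_add_distrib]
  refine Finset.sum_congr rfl fun i _ => ?_
  have hi : 1 ≤ w[i] := hw _ (List.getElem_mem _)
  rw [← Nat.sub_add_cancel hi, Finset.sum_range_succ']
  simp only [Nat.sub_add_cancel hi, Nat.sub_zero, zero_add]
  congr 1
  refine Finset.sum_congr rfl fun j _ => ?_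
  rw [show w[i] - 1 - (j + 1) = w[i] - 2 - j by lia]

theorem bilateral_mem_regular {w : List ℕ} (hw : AdmissibleWord w) (hne : w ≠ []) :
    bilateral w ∈ regular (w.length - 1) := by
  have hsum : 2 ≤ w.sum := by
    obtain ⟨k, u, rfl⟩ := List.exists_cons_of_ne_nil hne
    have := (admissibleWord_cons.1 hw).1
    rw [List.sum_cons]
    lia
  have hhigh : ∑ i : Fin w.length, ∑ j ∈ range (w[i] - 1),
      symSum (j + 2) (gapCoeff w i (w[i] - 2 - j)) ∈ regular (w.length - 1) :=
    sum_mem fun i _ => sum_mem fun j _ =>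
      symSum_mem_regular (Nat.le_add_left 2 j) (gapCoeff_mem_span hw i _)
  have hone : symSum 1 (∑ i : Fin w.length, gapCoeff w i (w[i] - 1)) ∈ errors :=
    symSum_one_mem_errors (sum_mem fun i _ => gapCoeff_mem_span hw i _) fun N => by
      simpa only [Finset.sum_apply] using sum_gapCoeff_eq_zero hw.1 hsum N
  have hdiag : ∑ i : Fin w.length, (fun N => gapCoeff w i w[i] N N) ∈ regular (w.length - 1) :=
    sum_mem fun i _ => diagonal_mem_regular (gapCoeff_mem_span hw i _)
  refine regular_congr (sub_mem (add_mem hhigh (mem_regular_of_mem_errors hone _)) hdiag)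
    fun N hN => ?_
  rw [bilateral_eq hw.1 (by lia) hN]
  simp only [Pi.sub_apply, Pi.add_apply, Finset.sum_apply]

theorem sum_map_mhs_properMergings_mem_regular {w : List ℕ} (hw : ∀ x ∈ w, 1 ≤ x) :
    (fun N => ((properMergings w).map (mhs · N)).sum) ∈ regular (w.length - 1) :=
  list_sum_mhs_mem_regular fun _ hc =>
    regular_mono (Nat.le_sub_one_of_lt (length_lt_of_mem_properMergings hc))
      (mhs_mem_regular (pos_of_mem_properMergings hw hc))

theorem mhsStar_mem_regular {w : List ℕ} (hw : ∀ x ∈ w, 1 ≤ x) : mhsStar w ∈ regular w.length := by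
  convert add_mem (mhs_mem_regular hw)
    (regular_mono (Nat.sub_le _ 1) (sum_map_mhs_properMergings_mem_regular hw)) using 1
  ext N
  exact mhsStar_eq w N

theorem negInv_mem_regular {w : List ℕ} (hw : ∀ x ∈ w, 1 ≤ x) :
    (fun N => negInv N w) ∈ regular w.length := by
  convert (regular _).smul_mem ((-1 : ℚ) ^ (w.length + w.sum)) (mhsStar_mem_regular hw) using 1
  ext N
  simp [negInv, Rat.smul_def]

theorem mhs_add_mhsStar {w : List ℕ} (hodd : Odd (w.length + w.sum)) {N : ℕ} (hN : 1 ≤ N) :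
    mhs w N + mhsStar w N =
      ∑ i ∈ range w.length, bilateral (w.take (i + 1)) N * negInv N (w.drop (i + 1)) := by
  have hconv := mhs_eq_conv hN w
  rw [conv, Finset.sum_range_succ'] at hconv
  simp only [List.take_zero, List.drop_zero, conv_nil, mhs_nil, chain_nil, one_mul, negInv,
    hodd.neg_one_pow, neg_one_mul] at hconv
  simpa only [bilateral, negInv, ← sub_eq_add_neg, eq_sub_iff_add_eq] using hconv

theorem mhs_mem_regular_of_parity {w : List ℕ} (hw : AdmissibleWord w)
    (hodd : Odd (w.length + w.sum)) : mhs w ∈ regular (w.length - 1) := by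
  have hsum : ∑ i ∈ range w.length,
      bilateral (w.take (i + 1)) * (fun N => negInv N (w.drop (i + 1))) ∈
        regular (w.length - 1) := by
    refine sum_mem fun i hi => ?_
    have hi := Finset.mem_range.1 hi
    have hne : w.take (i + 1) ≠ [] := List.ne_nil_of_length_pos (by rw [List.length_take]; lia)
    refine regular_mono ?_ (mul_mem_regular (bilateral_mem_regular (hw.take (i + 1)) hne)
      (negInv_mem_regular fun x hx => hw.1 x (List.mem_of_mem_drop hx)))
    rw [List.length_take, List.length_drop]
    lia
  refine regular_congr ((regular _).smul_mem (2⁻¹ : ℚ)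
    (sub_mem hsum (sum_map_mhs_properMergings_mem_regular hw.1))) fun N hN => ?_
  have htwo := mhs_add_mhsStar hodd hN
  rw [mhsStar_eq, ← add_assoc, ← two_mul, ← eq_sub_iff_add_eq] at htwo
  simp only [Pi.smul_apply, Pi.sub_apply, Finset.sum_apply, Pi.mul_apply, ← htwo, Rat.smul_def]
  push_cast
  ring

end Parity

end MZV

theorem theorem1p1 (d : ℕ) (k : Fin d → ℕ) (hk : MZV.Admissible k)
    (hpar : ¬ (∑ i, k i) ≡ d [MOD 2]) :
    MZV.zeta k ∈ Submodule.span MZV.ratPiSq (MZV.valuesOfDepthLE (d - 1)) := by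
  have hadm := MZV.admissibleWord_reverse_ofFn hk
  have hlength : (List.ofFn k).reverse.length = d := by simp
  have hodd : Odd ((List.ofFn k).reverse.length + (List.ofFn k).reverse.sum) := by
    rw [hlength, List.sum_reverse, List.sum_ofFn, Nat.odd_iff]
    unfold Nat.ModEq at hpar
    lia
  have htruncated := MZV.mhs_mem_regular_of_parity hadm hodd
  have herror := MZV.mem_regular_of_mem_errors
    (MZV.mhs_sub_mem_errors hadm (MZV.tendsto_mhs_zeta hk)) (d - 1)
  rw [hlength] at htruncated
  refine MZV.mem_depthSpan_of_const_mem_regular ?_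
  convert sub_mem htruncated herror using 1
  ext N
  simp
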